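/- **Setting.** Let $N,T\ge 1$ be integers with $NT\ge 2$, let $f_1,\dots,f_N:\mathbb Z\to\mathbb R$ be deterministic time series, let $\rho\in(0,1]$, and suppose that $L=\sqrt{\min(N,T)\,T}$ is an integer that divides $T$. For $n\in[N]$, $t\in[T]$ we observe $X_n(t)=f_n(t)+\eta_n(t)$ if $B_n(t)=1$ and $X_n(t)=\star$ (missing) if $B_n(t)=0$, where the $B_n(t)$ are independent Bernoulli($\rho$) variables, the $\eta_n(t)$ are independent with $\mathbb E[\eta_n(t)]=0$ and $\|\eta_n(t)\|_{\psi_2}=\sup_{p\ge1}p^{-1/2}(\mathbb E|\eta_n(t)|^p)^{1/p}\le\gamma$, and the family $(B_n(t))$ is independent of the family $(\eta_n(t))$. For $x_1,\dots,x_N$ on $[T]$ let $\mathsf{SP}(x)\in\mathbb R^{L\times(NT/L)}$ be the stacked Page matrix: its entry in row $i\in[L]$ and column $(n-1)T/L+j$, $j\in[T/L]$, is $x_n(i+(j-1)L)$. Let $\sigma_k$ denote the $k$-th largest singular value. **Assumptions.** Let $\Gamma_1,\Gamma_2,c>0$, $\gamma\ge0$, $\varepsilon\ge 0$, and let $R,G,k$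 be integers. 1. The matrix $(f_n(t))_{n\in[N],t\in[T]}$ has rank $R$, and $f_n(t)=\sum_{r=1}^R U_{nr}W_{rt}$ for $n\in[N]$, $t\in[T]$, with $|U_{nr}|\le\Gamma_1$ and $|W_{rt}|\le\Gamma_2$. 2. Each $W_{r\cdot}:\mathbb Z\to\mathbb R$ is a $(G,\varepsilon)$-Hankel time series: for every $T'\ge1$ there is a matrix of rank at most $G$ whose entries differ by at most $\varepsilon$ from those of the Hankel matrix $(W_{r,i+j-1})_{i,j\in[\lfloor T'/2\rfloor]}$. 3. (Approximately balanced spectra.) There is a matrix $\tilde M\in\mathbb R^{L\times(NT/L)}$ with $\operatorname{rank}\tilde M=k$, $1\le k\le RG$, $\|\mathsf{SP}(f)-\tilde M\|_\infty\le R\Gamma_1\varepsilon$ (maximum of the absolute values of the entries), and $\sigma_k(\tilde M)\ge c\sqrt{NT}/\sqrt k$. **Estimator (mSSA imputation with parameters $L$ and $k$).** Replace $\star$ by $0$ in $\mathsf{SP}(X)$, take a singular value decomposition $\sum_\ell s_\ell u_\ell v_\ell^{\mathsf T}$ with $s_1\ge s_2\ge\dots\ge0$, and form $\frac1{\hat\rho}\sum_{\ell\le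 k}s_\ell u_\ell v_\ell^{\mathsf T}$, where $\hat\rho=\max\bigl(1,\#\{(n,t):X_n(t)\ne\star\}\bigr)/(NT)$. The estimate $\hat f_n(t)$ is the entry of this matrix at the position of $x_n(t)$ in $\mathsf{SP}(x)$. If the singular value decomposition is not unique, any (measurable) choice is allowed. **Theorem.** There are an absolute constant $C>0$ and a polynomial $P$ in four variables with real coefficients, with $P(c,\Gamma_1,\Gamma_2,\gamma)>0$ for all $c,\Gamma_1,\Gamma_2>0$ and $\gamma\ge0$, such that in the setting above, whenever $\rho\ge C\,\dfrac{\log(NT)}{\sqrt{NT}}$, the squared errors $(f_n(t)-\hat f_n(t))^2$ are integrable and $$\frac1{NT}\sum_{n=1}^N\sum_{t=1}^T\mathbb E\bigl[(f_n(t)-\hat f_n(t))^2\bigr]\;\le\;P(c,\Gamma_1,\Gamma_2,\gamma)\left(\frac{R^3G\log(NT)}{\rho^4\sqrt{\min(N,T)\,T}}+\frac{R^4G(\varepsilon+\varepsilon^3)}{\rho^2}\right).$$ -/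

import Mathlib

open MeasureTheory ProbabilityTheory

namespace MSSA

noncomputable section

/-! ### Time series, Page and Hankel matrices

Time is counted from `1`; an index `t : Fin T` stands for the time `t + 1 ∈ {1, …, T}`. Matrix rows
and columns are likewise indexed from `0`. -/

/-- The restriction of the time series `f 0, …, f (N - 1)` to the times `1, …, T`. -/
def window {N : ℕ} (f : Fin N → ℤ → ℝ) (T : ℕ) (n : Fin N) (t : Fin T) : ℝ :=
  f n ((t : ℤ) + 1)

/-- The time index sitting in row `i` and column `j` of the `L × (T / L)` Page matrix. -/
def pageTime {T L : ℕ} (i : Fin L) (j : Fin (T / L)) : Fin T :=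
  ⟨i + j * L, by
    have h1 : (j : ℕ) + 1 ≤ T / L := j.2
    have h2 : ((j : ℕ) + 1) * L ≤ T / L * L := Nat.mul_le_mul_right L h1
    have h3 : T / L * L ≤ T := Nat.div_mul_le_self T L
    have h4 : (i : ℕ) < L := i.2
    have h5 : ((j : ℕ) + 1) * L = j * L + L := by ring
    omega⟩

/-- The stacked Page matrix, with `L` rows and `N * (T / L)` columns; the column `(n, j)` is the
`j`-th column of the Page matrix of the `n`-th time series. -/
def stackedPage {N T : ℕ} (L : ℕ) (x : Fin N → Fin T → ℝ) :
    Matrix (Fin L) (Fin N × Fin (T / L)) ℝ :=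
  Matrix.of fun i c => x c.1 (pageTime i c.2)

/-- Reading off `N` time series over `T` time steps from a matrix with the shape of a stacked Page
matrix: the value at time index `t` is in row `t mod L` and column `⌊t / L⌋` of the `n`-th block. -/
def readOff {N T L : ℕ} (hL : L ∣ T) (A : Matrix (Fin L) (Fin N × Fin (T / L)) ℝ)
    (n : Fin N) (t : Fin T) : ℝ :=
  A ⟨(t : ℕ) % L, Nat.mod_lt _ (Nat.pos_of_dvd_of_pos hL (Nat.zero_lt_of_lt t.2))⟩
    (n, ⟨(t : ℕ) / L, Nat.div_lt_div_of_lt_of_dvd hL t.2⟩)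

/-- The `⌊T/2⌋ × ⌊T/2⌋` Hankel matrix of a time series; its (one-based) `(i, j)` entry is
`g (i + j - 1)`. -/
def hankel (g : ℤ → ℝ) (T : ℕ) : Matrix (Fin (T / 2)) (Fin (T / 2)) ℝ :=
  Matrix.of fun i j => g ((i : ℤ) + (j : ℤ) + 1)

/-- `A` has `ε`-approximate rank at most `s`: it is entrywise `ε`-close to a matrix of rank at
most `s`. -/
def HasApproxRank {m n : Type*} [Fintype n] (A : Matrix m n ℝ) (ε : ℝ) (s : ℕ) : Prop :=
  ∃ B : Matrix m n ℝ, B.rank ≤ s ∧ ∀ i j, |A i j - B i j| ≤ ε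

/-- `(G, ε)`-Hankel time series. -/
def IsHankelSeries (G : ℕ) (ε : ℝ) (g : ℤ → ℝ) : Prop :=
  ∀ T : ℕ, 1 ≤ T → HasApproxRank (hankel g T) ε G

/-! ### The spatio-temporal factor model -/

/-- The `N × T` mean matrix has rank `R` and is factorized through bounded spatial factors `U` and
bounded temporal factors `W`. -/
structure IsFactorModel {N : ℕ} (f : Fin N → ℤ → ℝ) (T R : ℕ) (Γ₁ Γ₂ : ℝ)
    (U : Fin N → Fin R → ℝ) (W : Fin R → ℤ → ℝ) : Prop where
  rank_eq : (Matrix.of (window f T)).rank = R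
  factor : ∀ n, ∀ t : ℤ, 1 ≤ t → t ≤ T → f n t = ∑ r, U n r * W r t
  spatial_bound : ∀ n r, |U n r| ≤ Γ₁
  temporal_bound : ∀ r, ∀ t : ℤ, 1 ≤ t → t ≤ T → |W r t| ≤ Γ₂

/-- The `k`-th largest singular value of a matrix, `k = 1, 2, …` (Mathlib counts from `0`). -/
def singularValue {m n : Type*} [Fintype m] [Fintype n] [DecidableEq n]
    (k : ℕ) (A : Matrix m n ℝ) : ℝ :=
  A.toEuclideanLin.singularValues (k - 1)

/-- Approximately balanced spectra, with the rank `k` of the approximating matrix exposed. -/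
def ApproxBalancedSpectra {N : ℕ} (f : Fin N → ℤ → ℝ) (T L R G : ℕ) (Γ₁ ε c : ℝ) (k : ℕ) : Prop :=
  ∃ M : Matrix (Fin L) (Fin N × Fin (T / L)) ℝ,
    M.rank = k ∧ 1 ≤ k ∧ k ≤ R * G ∧
    (∀ i j, |stackedPage L (window f T) i j - M i j| ≤ R * Γ₁ * ε) ∧
    c * √((N : ℝ) * T) / √(k : ℝ) ≤ singularValue k M

/-! ### Noise and missing observations -/

/-- The sub-gaussian norm `sup_{p ≥ 1} p^{-1/2} (𝔼 |X|^p)^{1/p}`. -/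
def psiTwoNorm {Ω : Type*} [MeasurableSpace Ω] (μ : Measure Ω) (X : Ω → ℝ) : ENNReal :=
  ⨆ p : {p : ℝ // 1 ≤ p}, eLpNorm X (ENNReal.ofReal p) μ / ENNReal.ofReal √(p : ℝ)

/-- The noise `η` consists of independent centred sub-gaussian variables, every entry is revealed
(`B n t = true`) independently with probability `ρ`, and the noise and the pattern of revealed
entries are independent of each other. -/
structure IsObservationModel {Ω : Type*} [MeasurableSpace Ω] (μ : Measure Ω) {N T : ℕ}
    (η : Fin N → Fin T → Ω → ℝ) (B : Fin N → Fin T → Ω → Bool) (ρ γ : ℝ) : Prop where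
  measurable_noise : ∀ n t, Measurable (η n t)
  measurable_mask : ∀ n t, Measurable (B n t)
  indep_noise : iIndepFun (fun (i : Fin N × Fin T) ω => η i.1 i.2 ω) μ
  indep_mask : iIndepFun (fun (i : Fin N × Fin T) ω => B i.1 i.2 ω) μ
  indep_noise_mask : IndepFun (fun ω (i : Fin N × Fin T) => η i.1 i.2 ω)
    (fun ω (i : Fin N × Fin T) => B i.1 i.2 ω) μ
  integral_noise : ∀ n t, ∫ ω, η n t ω ∂μ = 0
  noise_norm : ∀ n t, psiTwoNorm μ (η n t) ≤ ENNReal.ofReal γ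
  mask_prob : ∀ n t, μ {ω | B n t ω = true} = ENNReal.ofReal ρ

/-- The observed data at the outcome `ω`; `none` is a missing observation. -/
def observation {Ω : Type*} {N T : ℕ} (f : Fin N → ℤ → ℝ) (η : Fin N → Fin T → Ω → ℝ)
    (B : Fin N → Fin T → Ω → Bool) (ω : Ω) (n : Fin N) (t : Fin T) : Option ℝ :=
  if B n t ω = true then some (window f T n t + η n t ω) else none

/-! ### Imputation by mSSA -/

/-- `A = ∑ ℓ, s ℓ • u ℓ (v ℓ)ᵀ` is a singular value decomposition with ordered singular values. -/
structure IsSVD {m n : Type*} [Fintype m] [Fintype n] (A : Matrix m n ℝ)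
    (s : Fin (min (Fintype.card m) (Fintype.card n)) → ℝ)
    (u : Fin (min (Fintype.card m) (Fintype.card n)) → EuclideanSpace ℝ m)
    (v : Fin (min (Fintype.card m) (Fintype.card n)) → EuclideanSpace ℝ n) : Prop where
  antitone : Antitone s
  nonneg : ∀ l, 0 ≤ s l
  orthonormal_left : Orthonormal ℝ u
  orthonormal_right : Orthonormal ℝ v
  decomp : ∀ i j, A i j = ∑ l, s l * u l i * v l j

/-- `S` is the sum of the `k` leading terms of some singular value decomposition of `A` (which is
unique unless the `k`-th and the next singular value agree). -/
def IsTruncatedSVD {m n : Type*} [Fintype m] [Fintype n] (k : ℕ) (A S : Matrix m n ℝ) : Prop :=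
  ∃ s u v, IsSVD A s u v ∧
    ∀ i j, S i j = ∑ l : Fin (min (Fintype.card m) (Fintype.card n)),
      if (l : ℕ) < k then s l * u l i * v l j else 0

/-- The fraction of observed entries, with the number of observed entries replaced by `1` if it
vanishes. -/
def rhoHat {N T : ℕ} (X : Fin N → Fin T → Option ℝ) : ℝ :=
  max 1 (∑ n, ∑ t, if (X n t).isSome then 1 else 0) / ((N : ℝ) * T)

/-- `fhat` is an output of the mSSA imputation algorithm with parameters `L` and `k` on the data
`X`: missing values are replaced by `0`, the stacked Page matrix is replaced by the leading `k`
terms of its singular value decomposition and divided by `rhoHat`, and `fhat` is read off. -/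
def IsMSSAImputation {N T L : ℕ} (hL : L ∣ T) (k : ℕ) (X : Fin N → Fin T → Option ℝ)
    (fhat : Fin N → Fin T → ℝ) : Prop :=
  ∃ S : Matrix (Fin L) (Fin N × Fin (T / L)) ℝ,
    IsTruncatedSVD k (stackedPage L fun n t => (X n t).getD 0) S ∧
    ∀ n t, fhat n t = readOff hL ((rhoHat X)⁻¹ • S) n t

/-- The mean-squared imputation error. -/
def impErr {Ω : Type*} [MeasurableSpace Ω] (μ : Measure Ω) {N T : ℕ} (f : Fin N → ℤ → ℝ)
    (fhat : Ω → Fin N → Fin T → ℝ) : ℝ :=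
  1 / ((N : ℝ) * T) * ∑ n, ∑ t, ∫ ω, (window f T n t - fhat ω n t) ^ 2 ∂μ

end

end MSSA

/-!
Write `M` for the stacked Page matrix of the means, `Z` for that of the data with missing values
replaced by `0`, and `E = Z - ρ M`, a matrix with independent centred entries. The approximating
matrix `A` has rank `k` and is entrywise close to `M`.

The leading part `S` of the singular value decomposition of `Z` satisfies
`‖S - ρ A‖_F² ≤ 8 k ‖Z - ρ A‖²`: the discarded part is no larger, in operator norm, than the distance
of `Z` to any matrix of rank at most `k` (`norm_sub_le_of_isTruncatedSVD`), the difference `S - ρ A`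
has rank at most `2 k`, and a matrix of rank `r` has squared Frobenius norm at most `r` times its
squared operator norm (`sum_sq_le_rank_mul_norm_sq`). As `k ≤ R G`, it remains to bound `𝔼 ‖E‖²` by
a multiple of the number of columns, `N T / L`.

For that, every linear combination of the entries of `E` is sub-Gaussian
(`isJointlySubgaussian_masked`, which conditions on the mask). The bilinear form of `E` is at least
`‖E‖ / 4` on a product of two balls of radius `1 / 4` inside balls of radius `2`; integrating its
exponential over the large balls therefore controls `exp (t ‖E‖ / 4)` up to a ratio of volumes that
is exponential in the dimensions (`lintegral_exp_norm_le`). This replaces a union bound over a net.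

Finally `ρ` is estimated by the fraction of revealed entries, with variance at most `1 / (4 N T)`.
Where this fraction is at least `ρ / 2` the bounds above apply (`sum_sq_error_le`). The complementary
event has probability at most `(N T)⁻³` by Hoeffding's inequality and the lower bound on `ρ`; it
depends on the mask alone, so that it is independent of the noise, and a crude bound suffices there
(`sum_sq_error_le_of_inv_card_le`).
-/

namespace MSSA

/-! ### Low-rank approximation by truncated singular value decompositions -/

section LowRank

open scoped Matrix.Norms.L2Operator
open Module (finrank)

variable {m n : Type*} [Fintype n]

lemma norm_sq_sum_smul_of_orthonormal {E ι : Type*} [NormedAddCommGroup E] [InnerProductSpace ℝ E]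
    [Fintype ι] {v : ι → E} (hv : Orthonormal ℝ v) (a : ι → ℝ) :
    ‖∑ l, a l • v l‖ ^ 2 = ∑ l, a l ^ 2 := by
  rw [← real_inner_self_eq_norm_sq, hv.inner_sum]
  simp [sq]

lemma rank_sub_le (A B : Matrix m n ℝ) : (A - B).rank ≤ A.rank + B.rank := by
  simp only [Matrix.rank]
  refine le_trans (Submodule.finrank_mono (?_ : _ ≤ A.mulVecLin.range ⊔ B.mulVecLin.range))
    (Submodule.finrank_add_le_finrank_add_finrank _ _)
  rintro _ ⟨x, rfl⟩
  rw [Matrix.mulVecLin_apply, Matrix.sub_mulVec]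
  exact sub_mem (Submodule.mem_sup_left ⟨x, rfl⟩) (Submodule.mem_sup_right ⟨x, rfl⟩)

lemma toEuclideanLin_eq_sum [DecidableEq n] {A : Matrix m n ℝ} {ι : Type*} [Fintype ι] {s : ι → ℝ}
    {u : ι → EuclideanSpace ℝ m} {v : ι → EuclideanSpace ℝ n}
    (h : ∀ i j, A i j = ∑ l, s l * u l i * v l j) (x : EuclideanSpace ℝ n) :
    A.toEuclideanLin x = ∑ l, (s l * inner ℝ (v l) x) • u l := by
  ext i
  simp only [Matrix.toLpLin_apply, Matrix.mulVec, dotProduct, h, PiLp.inner_apply,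
    RCLike.inner_apply, conj_trivial, WithLp.ofLp_sum, WithLp.ofLp_smul, Finset.sum_apply,
    Pi.smul_apply, smul_eq_mul, Finset.sum_mul, Finset.mul_sum]
  rw [Finset.sum_comm]
  exact Finset.sum_congr rfl fun i _ => Finset.sum_congr rfl fun j _ => by ring

lemma rank_le_of_isTruncatedSVD [Fintype m] {k : ℕ} {A S : Matrix m n ℝ}
    (hS : IsTruncatedSVD k A S) : S.rank ≤ k := by
  classical
  obtain ⟨s, u, v, -, hS⟩ := hS
  let P : Matrix m {l : Fin (min (Fintype.card m) (Fintype.card n)) // l.1 < k} ℝ :=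
    Matrix.of fun i l => s l * u l i
  let Q : Matrix {l : Fin (min (Fintype.card m) (Fintype.card n)) // l.1 < k} n ℝ :=
    Matrix.of fun l j => v l j
  have h : S = P * Q := by
    ext i j
    rw [hS, Matrix.mul_apply, ← Finset.sum_filter]
    exact Finset.sum_subtype _ (by simp) _
  rw [h]
  refine (Matrix.rank_mul_le_left _ _).trans ((Matrix.rank_le_card_width _).trans ?_)
  simpa using Fintype.card_le_of_injective
    (fun l : {l : Fin (min (Fintype.card m) (Fintype.card n)) // l.1 < k} => (⟨l.1, l.2⟩ : Fin k))
    (fun a b hab => Subtype.ext (Fin.ext (by simpa using hab)))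

lemma sum_sq_eq_of_orthonormal [Fintype m] {M : ℕ} {A : Matrix m n ℝ} {s : Fin M → ℝ}
    {u : Fin M → EuclideanSpace ℝ m} {v : Fin M → EuclideanSpace ℝ n}
    (hu : Orthonormal ℝ u) (hv : Orthonormal ℝ v)
    (h : ∀ i j, A i j = ∑ l, s l * u l i * v l j) :
    ∑ i, ∑ j, A i j ^ 2 = ∑ l, s l ^ 2 := by
  have hcol : ∀ j, ∑ i, A i j ^ 2 = ∑ l, (s l * v l j) ^ 2 := by
    intro j
    rw [← norm_sq_sum_smul_of_orthonormal hu, EuclideanSpace.norm_sq_eq]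
    refine Finset.sum_congr rfl fun i _ => ?_
    rw [h, Real.norm_eq_abs, sq_abs]
    congr 1
    simp only [WithLp.ofLp_sum, WithLp.ofLp_smul, Finset.sum_apply, Pi.smul_apply, smul_eq_mul]
    exact Finset.sum_congr rfl fun l _ => by ring
  rw [Finset.sum_comm]
  simp only [hcol, mul_pow]
  rw [Finset.sum_comm]
  refine Finset.sum_congr rfl fun l _ => ?_
  have h1 : ‖v l‖ ^ 2 = 1 := by rw [hv.1 l, one_pow]
  rw [EuclideanSpace.norm_sq_eq] at h1
  simp only [Real.norm_eq_abs, sq_abs] at h1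
  rw [← Finset.mul_sum, h1, mul_one]

lemma sum_sq_le_of_isTruncatedSVD [Fintype m] {k : ℕ} {A S : Matrix m n ℝ}
    (hS : IsTruncatedSVD k A S) :
    ∑ i, ∑ j, S i j ^ 2 ≤ ∑ i, ∑ j, A i j ^ 2 := by
  obtain ⟨s, u, v, hA, hS⟩ := hS
  have hS' : ∀ i j, S i j = ∑ l, (if l.1 < k then s l else 0) * u l i * v l j := by
    intro i j
    rw [hS]
    exact Finset.sum_congr rfl fun l _ => by split_ifs <;> ring
  rw [sum_sq_eq_of_orthonormal hA.orthonormal_left hA.orthonormal_right hA.decomp,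
    sum_sq_eq_of_orthonormal hA.orthonormal_left hA.orthonormal_right hS']
  refine Finset.sum_le_sum fun l _ => ?_
  split_ifs
  · exact le_rfl
  · rw [zero_pow two_ne_zero]
    exact sq_nonneg _

variable [Fintype m] [DecidableEq n]

lemma norm_toEuclideanLin_le (A : Matrix m n ℝ) (x : EuclideanSpace ℝ n) :
    ‖A.toEuclideanLin x‖ ≤ ‖A‖ * ‖x‖ :=
  A.l2_opNorm_mulVec x

lemma l2_opNorm_le_bound (A : Matrix m n ℝ) {C : ℝ} (hC : 0 ≤ C)
    (h : ∀ x : EuclideanSpace ℝ n, ‖A.toEuclideanLin x‖ ≤ C * ‖x‖) : ‖A‖ ≤ C := by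
  rw [Matrix.l2_opNorm_def]
  exact ContinuousLinearMap.opNorm_le_bound _ hC h

lemma finrank_range_toEuclideanLin (A : Matrix m n ℝ) :
    finrank ℝ A.toEuclideanLin.range = A.rank :=
  (A.rank_eq_finrank_range_toLin (EuclideanSpace.basisFun m ℝ).toBasis
    (EuclideanSpace.basisFun n ℝ).toBasis).symm ▸ by
    rw [Matrix.toEuclideanLin_eq_toLin_orthonormal]

lemma inner_toEuclideanLin (A : Matrix m n ℝ) (u : EuclideanSpace ℝ m) (v : EuclideanSpace ℝ n) :
    inner ℝ u (A.toEuclideanLin v) = ∑ i, ∑ j, u i * v j * A i j := by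
  simp only [PiLp.inner_apply, Matrix.toLpLin_apply, Matrix.mulVec, dotProduct,
    RCLike.inner_apply, conj_trivial, Finset.sum_mul]
  exact Finset.sum_congr rfl fun i _ => Finset.sum_congr rfl fun j _ => by ring

/-- The squared Frobenius norm is the sum of the squared singular values, of which at most `rank`
many do not vanish. The proof expands the columns in an orthonormal basis of the column space. -/
lemma sum_sq_le_rank_mul_norm_sq (D : Matrix m n ℝ) :
    ∑ i, ∑ j, D i j ^ 2 ≤ D.rank * ‖D‖ ^ 2 := by
  classical
  set V := D.toEuclideanLin.range
  let b := stdOrthonormalBasis ℝ V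
  have hcol : ∀ j, ∑ i, D i j ^ 2
      = ∑ a, (inner ℝ (b a : EuclideanSpace ℝ m)
          (D.toEuclideanLin (EuclideanSpace.single j 1))) ^ 2 := by
    intro j
    have h := b.sum_sq_norm_inner_right
      ⟨D.toEuclideanLin (EuclideanSpace.single j 1), LinearMap.mem_range_self _ _⟩
    simp only [Submodule.coe_inner, Submodule.coe_norm, Real.norm_eq_abs, sq_abs] at h
    rw [h, EuclideanSpace.norm_sq_eq]
    simp [Matrix.toLpLin_apply, Matrix.mulVec_single]
  have hrow : ∀ a, ∑ j, (inner ℝ (b a : EuclideanSpace ℝ m)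
      (D.toEuclideanLin (EuclideanSpace.single j 1))) ^ 2 ≤ ‖D‖ ^ 2 := by
    intro a
    have h1 := norm_toEuclideanLin_le D.transpose (b a : EuclideanSpace ℝ m)
    have h2 : ‖(b a : EuclideanSpace ℝ m)‖ = 1 := by
      rw [← Submodule.coe_norm]
      exact b.orthonormal.1 a
    have h3 : ‖D.transpose‖ = ‖D‖ := by
      rw [← Matrix.conjTranspose_eq_transpose_of_trivial, Matrix.l2_opNorm_conjTranspose]
    rw [h2, mul_one, h3] at h1
    calc _ = ‖D.transpose.toEuclideanLin (b a : EuclideanSpace ℝ m)‖ ^ 2 := by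
          rw [EuclideanSpace.norm_sq_eq]
          refine Finset.sum_congr rfl fun j _ => ?_
          rw [Real.norm_eq_abs, sq_abs, inner_toEuclideanLin]
          simp [Matrix.toLpLin_apply, Matrix.mulVec, dotProduct, mul_comm]
      _ ≤ ‖D‖ ^ 2 := by gcongr
  calc ∑ i, ∑ j, D i j ^ 2 = ∑ j, ∑ i, D i j ^ 2 := Finset.sum_comm
    _ = ∑ j, ∑ a, (inner ℝ (b a : EuclideanSpace ℝ m)
          (D.toEuclideanLin (EuclideanSpace.single j 1))) ^ 2 :=
        Finset.sum_congr rfl fun j _ => hcol j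
    _ = ∑ a, ∑ j, (inner ℝ (b a : EuclideanSpace ℝ m)
          (D.toEuclideanLin (EuclideanSpace.single j 1))) ^ 2 := Finset.sum_comm
    _ ≤ ∑ _a : Fin (finrank ℝ V), ‖D‖ ^ 2 := Finset.sum_le_sum fun a _ => hrow a
    _ = D.rank * ‖D‖ ^ 2 := by
        rw [Finset.sum_const, Finset.card_univ, Fintype.card_fin, nsmul_eq_mul,
          finrank_range_toEuclideanLin]

/-- The discarded part of a singular value decomposition is at most as large, in operator norm, as
the distance from `A` to any matrix of rank at most `k`: some nonzero combination of the leading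
`k + 1` right singular vectors lies in the kernel of such a matrix. -/
lemma norm_sub_le_of_isTruncatedSVD {k : ℕ} {A S B : Matrix m n ℝ}
    (hS : IsTruncatedSVD k A S) (hB : B.rank ≤ k) : ‖A - S‖ ≤ ‖A - B‖ := by
  classical
  obtain ⟨s, u, v, hA, hS⟩ := hS
  have hdiff : ∀ i j, (A - S) i j = ∑ l, (if l.1 < k then 0 else s l) * u l i * v l j := by
    intro i j
    rw [Matrix.sub_apply, hA.decomp, hS, ← Finset.sum_sub_distrib]
    refine Finset.sum_congr rfl fun l _ => ?_
    split_ifs <;> ring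
  by_cases hk : k < min (Fintype.card m) (Fintype.card n)
  swap
  · refine l2_opNorm_le_bound _ (norm_nonneg _) fun x => ?_
    rw [toEuclideanLin_eq_sum hdiff, Finset.sum_eq_zero]
    · rw [norm_zero]; positivity
    · intro l _
      rw [if_pos (lt_of_lt_of_le l.2 (not_lt.1 hk)), zero_mul, zero_smul]
  set σ := s ⟨k, hk⟩ with hσ
  have hσ0 : 0 ≤ σ := hA.nonneg _
  have h1 : ‖A - S‖ ≤ σ := by
    refine l2_opNorm_le_bound _ hσ0 fun x => ?_
    rw [toEuclideanLin_eq_sum hdiff]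
    refine le_of_sq_le_sq ?_ (by positivity)
    rw [norm_sq_sum_smul_of_orthonormal hA.orthonormal_left, mul_pow]
    calc _ ≤ ∑ l, σ ^ 2 * ‖inner ℝ (v l) x‖ ^ 2 := by
          refine Finset.sum_le_sum fun l _ => ?_
          rw [mul_pow, Real.norm_eq_abs, sq_abs]
          refine mul_le_mul_of_nonneg_right ?_ (sq_nonneg _)
          split_ifs with h
          · rw [zero_pow two_ne_zero]; positivity
          · exact pow_le_pow_left₀ (hA.nonneg _) (hA.antitone (Fin.mk_le_of_le_val (not_lt.1 h))) 2
      _ ≤ σ ^ 2 * ‖x‖ ^ 2 := by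
          rw [← Finset.mul_sum]
          gcongr
          exact hA.orthonormal_right.sum_inner_products_le x
  have h2 : σ ≤ ‖A - B‖ := by
    let e : Fin (k + 1) → Fin (min (Fintype.card m) (Fintype.card n)) :=
      fun a => ⟨a, lt_of_lt_of_le a.2 hk⟩
    have he : Function.Injective e := fun a b h => Fin.ext (by simpa [e] using h)
    let F : (Fin (k + 1) → ℝ) →ₗ[ℝ] B.toEuclideanLin.range :=
      B.toEuclideanLin.rangeRestrict ∘ₗ Fintype.linearCombination ℝ (fun a => v (e a))
    have hF : F.ker ≠ ⊥ := by
      refine LinearMap.ker_ne_bot_of_finrank_lt ?_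
      rw [finrank_range_toEuclideanLin, Module.finrank_fin_fun]
      omega
    obtain ⟨a, haF, ha0⟩ := Submodule.exists_mem_ne_zero_of_ne_bot hF
    set x : EuclideanSpace ℝ n := ∑ b, a b • v (e b) with hx
    have hBx : B.toEuclideanLin x = 0 := by
      have := congrArg Subtype.val (LinearMap.mem_ker.1 haF)
      simpa [F, hx, Fintype.linearCombination_apply] using this
    have hxn : ‖x‖ ^ 2 = ∑ b, a b ^ 2 :=
      norm_sq_sum_smul_of_orthonormal (hA.orthonormal_right.comp e he) a
    have hpos : 0 < ‖x‖ ^ 2 := by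
      rw [hxn]
      obtain ⟨b, hb⟩ := Function.ne_iff.1 ha0
      exact Finset.sum_pos' (fun _ _ => sq_nonneg _) ⟨b, Finset.mem_univ _, by
        have : a b ≠ 0 := hb
        positivity⟩
    have hAx : A.toEuclideanLin x = ∑ b, (s (e b) * a b) • u (e b) := by
      rw [hx, map_sum]
      refine Finset.sum_congr rfl fun b _ => ?_
      rw [map_smul, toEuclideanLin_eq_sum hA.decomp]
      simp only [orthonormal_iff_ite.1 hA.orthonormal_right]
      rw [Finset.sum_eq_single (e b)]
      · simp [smul_smul, mul_comm]
      · intro l _ hl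
        simp [hl]
      · simp
    have hAxn : σ ^ 2 * ‖x‖ ^ 2 ≤ ‖A.toEuclideanLin x‖ ^ 2 := by
      rw [hAx, norm_sq_sum_smul_of_orthonormal (v := fun b => u (e b))
        (hA.orthonormal_left.comp e he), hxn, Finset.mul_sum]
      refine Finset.sum_le_sum fun b _ => ?_
      rw [mul_pow]
      refine mul_le_mul_of_nonneg_right ?_ (sq_nonneg _)
      exact pow_le_pow_left₀ hσ0 (hA.antitone (Fin.mk_le_mk.2 (Nat.lt_succ_iff.1 b.2))) 2
    have hABx := norm_toEuclideanLin_le (A - B) x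
    rw [map_sub, LinearMap.sub_apply, hBx, sub_zero] at hABx
    have hsq : σ ^ 2 * ‖x‖ ^ 2 ≤ ‖A - B‖ ^ 2 * ‖x‖ ^ 2 := by
      rw [← mul_pow ‖A - B‖]
      exact hAxn.trans (by gcongr)
    exact le_of_sq_le_sq (le_of_mul_le_mul_right hsq hpos) (norm_nonneg _)
  exact h1.trans h2

/-- Truncating the singular value decomposition of a perturbation of a matrix `B` of rank at most
`k` recovers `B` in Frobenius norm, with an error governed by the operator norm of the
perturbation. -/
lemma sum_sq_sub_le_of_isTruncatedSVD {k : ℕ} {A S B : Matrix m n ℝ}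
    (hS : IsTruncatedSVD k A S) (hB : B.rank ≤ k) :
    ∑ i, ∑ j, (S i j - B i j) ^ 2 ≤ 8 * k * ‖A - B‖ ^ 2 := by
  have h1 : ‖S - B‖ ≤ 2 * ‖A - B‖ := by
    have h2 := norm_sub_le (A - B) (A - S)
    rw [sub_sub_sub_cancel_left] at h2
    linarith [norm_sub_le_of_isTruncatedSVD hS hB]
  have h3 : ((S - B).rank : ℝ) ≤ 2 * k := by
    have := (rank_sub_le S B).trans (add_le_add (rank_le_of_isTruncatedSVD hS) hB)
    rw [two_mul]
    exact_mod_cast this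
  calc _ ≤ ((S - B).rank : ℝ) * ‖S - B‖ ^ 2 := sum_sq_le_rank_mul_norm_sq (S - B)
    _ ≤ (2 * k) * (2 * ‖A - B‖) ^ 2 := by gcongr
    _ = _ := by ring

lemma norm_sq_le_sum_sq (A : Matrix m n ℝ) : ‖A‖ ^ 2 ≤ ∑ i, ∑ j, A i j ^ 2 := by
  have h0 : 0 ≤ ∑ i, ∑ j, A i j ^ 2 := by positivity
  refine (Real.le_sqrt (norm_nonneg _) h0).1 ?_
  refine l2_opNorm_le_bound _ (Real.sqrt_nonneg _) fun x => ?_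
  refine le_of_sq_le_sq ?_ (by positivity)
  rw [mul_pow, Real.sq_sqrt h0, EuclideanSpace.norm_sq_eq, EuclideanSpace.norm_sq_eq,
    Finset.sum_mul]
  refine Finset.sum_le_sum fun i _ => ?_
  simp only [Real.norm_eq_abs, sq_abs]
  simp only [Matrix.toLpLin_apply, Matrix.mulVec, dotProduct]
  exact Finset.sum_mul_sq_le_sq_mul_sq _ _ _

end LowRank

/-! ### The operator norm of a random matrix with sub-Gaussian entries -/

section OperatorNorm

open scoped Matrix.Norms.L2Operator
open Metric (ball)

variable {m n : Type*} [Fintype m] [Fintype n] [DecidableEq n]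

lemma continuous_l2_opNorm :
    Continuous fun A : m → n → ℝ => ‖(Matrix.of A : Matrix m n ℝ)‖ :=
  continuous_norm (E := Matrix m n ℝ)

lemma exists_inner_toEuclideanLin_ge (A : Matrix m n ℝ) :
    ∃ (u : EuclideanSpace ℝ m) (v : EuclideanSpace ℝ n), ‖u‖ ≤ 1 ∧ ‖v‖ ≤ 1 ∧
      9 / 10 * ‖A‖ ≤ inner ℝ u (A.toEuclideanLin v) := by
  rcases eq_or_lt_of_le (norm_nonneg A) with h0 | h0
  · exact ⟨0, 0, by simp, by simp, by simp [← h0]⟩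
  obtain ⟨v, hv, hAv⟩ := ContinuousLinearMap.exists_lt_apply_of_lt_opNorm
    (Matrix.toEuclideanLin.trans LinearMap.toContinuousLinearMap A) (r := 9 / 10 * ‖A‖) (by
      rw [← Matrix.l2_opNorm_def]; linarith)
  replace hAv : 9 / 10 * ‖A‖ < ‖A.toEuclideanLin v‖ := hAv
  have hpos : 0 < ‖A.toEuclideanLin v‖ := lt_trans (by positivity) hAv
  refine ⟨‖A.toEuclideanLin v‖⁻¹ • A.toEuclideanLin v, v, ?_, hv.le, ?_⟩
  · rw [norm_smul, norm_inv, norm_norm, inv_mul_cancel₀ hpos.ne']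
  · rw [real_inner_smul_left, real_inner_self_eq_norm_sq, sq, inv_mul_cancel_left₀ hpos.ne']
    exact hAv.le

/-- Near a pair of almost optimal unit vectors the bilinear form of `A` is comparable to `‖A‖`, so
that an exponential of the norm is bounded by an integral of exponentials of the bilinear form. -/
lemma exp_norm_mul_volume_le (A : Matrix m n ℝ) {t : ℝ} (ht : 0 ≤ t) :
    ENNReal.ofReal (Real.exp (t * ‖A‖ / 4)) *
        (volume (ball (0 : EuclideanSpace ℝ m) (1 / 4)) *
          volume (ball (0 : EuclideanSpace ℝ n) (1 / 4))) ≤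
      ∫⁻ p in ball (0 : EuclideanSpace ℝ m) 2 ×ˢ ball (0 : EuclideanSpace ℝ n) 2,
        ENNReal.ofReal (Real.exp (t * inner ℝ p.1 (A.toEuclideanLin p.2))) := by
  obtain ⟨u₀, v₀, hu₀, hv₀, h⟩ := exists_inner_toEuclideanLin_ge A
  have hsub : ball u₀ (1 / 4) ×ˢ ball v₀ (1 / 4) ⊆
      ball (0 : EuclideanSpace ℝ m) 2 ×ˢ ball (0 : EuclideanSpace ℝ n) 2 :=
    Set.prod_mono
      (Metric.ball_subset_ball' (by rw [dist_zero_right]; linarith))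
      (Metric.ball_subset_ball' (by rw [dist_zero_right]; linarith))
  refine le_trans ?_ (lintegral_mono_set hsub)
  rw [← Measure.addHaar_ball_center volume u₀, ← Measure.addHaar_ball_center volume v₀,
    ← Measure.prod_prod, ← Measure.volume_eq_prod, ← setLIntegral_const]
  refine setLIntegral_mono' (Metric.isOpen_ball.measurableSet.prod
    Metric.isOpen_ball.measurableSet) fun p hp => ?_
  refine ENNReal.ofReal_le_ofReal (Real.exp_le_exp.2 ?_)
  rw [mul_div_assoc]
  refine mul_le_mul_of_nonneg_left ?_ ht
  have hp1 : ‖p.1 - u₀‖ ≤ 1 / 4 := by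
    rw [← dist_eq_norm]; exact (Metric.mem_ball.1 hp.1).le
  have hp2 : ‖p.2 - v₀‖ ≤ 1 / 4 := by
    rw [← dist_eq_norm]; exact (Metric.mem_ball.1 hp.2).le
  have hu : ‖p.1‖ ≤ 5 / 4 := by
    have := norm_add_le u₀ (p.1 - u₀)
    rw [add_sub_cancel] at this
    linarith
  have e : inner ℝ p.1 (A.toEuclideanLin p.2) = inner ℝ u₀ (A.toEuclideanLin v₀)
      + inner ℝ (p.1 - u₀) (A.toEuclideanLin v₀)
      + inner ℝ p.1 (A.toEuclideanLin (p.2 - v₀)) := by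
    rw [map_sub, inner_sub_left, inner_sub_right]; ring
  have b1 : |inner ℝ (p.1 - u₀) (A.toEuclideanLin v₀)| ≤ 1 / 4 * ‖A‖ := by
    refine (abs_real_inner_le_norm _ _).trans (mul_le_mul hp1 ?_ (norm_nonneg _) (by norm_num))
    exact (norm_toEuclideanLin_le A v₀).trans (mul_le_of_le_one_right (norm_nonneg _) hv₀)
  have b2 : |inner ℝ p.1 (A.toEuclideanLin (p.2 - v₀))| ≤ 5 / 4 * (‖A‖ * (1 / 4)) := by
    refine (abs_real_inner_le_norm _ _).trans (mul_le_mul hu ?_ (norm_nonneg _) (by norm_num))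
    exact (norm_toEuclideanLin_le A _).trans (mul_le_mul_of_nonneg_left hp2 (norm_nonneg _))
  have := neg_le_of_abs_le b1
  have := neg_le_of_abs_le b2
  linarith [norm_nonneg A]

variable {Ω : Type*} [MeasurableSpace Ω] {μ : Measure Ω}

/-- The family `X` is jointly sub-Gaussian with parameter `K`: every combination `∑ a i * X i`
satisfies `𝔼 exp (∑ a i * X i) ≤ exp (K * ∑ a i ^ 2)`. -/
def IsJointlySubgaussian {ι : Type*} [Fintype ι] (μ : Measure Ω) (X : Ω → ι → ℝ) (K : ℝ) : Prop :=
  ∀ a : ι → ℝ, ∫⁻ ω, ENNReal.ofReal (Real.exp (∑ i, a i * X ω i)) ∂μ ≤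
    ENNReal.ofReal (Real.exp (K * ∑ i, a i ^ 2))

lemma volume_ball_two {ι : Type*} [Fintype ι] :
    volume (ball (0 : EuclideanSpace ℝ ι) 2) =
      ENNReal.ofReal (8 ^ Fintype.card ι) * volume (ball (0 : EuclideanSpace ℝ ι) (1 / 4)) := by
  have h := Measure.addHaar_ball_mul_of_pos (volume : Measure (EuclideanSpace ℝ ι)) 0
    (r := 8) (by norm_num) (1 / 4)
  rw [finrank_euclideanSpace] at h
  rw [← h]
  norm_num

lemma lintegral_exp_norm_le [SFinite μ] {A : Ω → Matrix m n ℝ} {K t : ℝ} (ht : 0 ≤ t)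
    (hK : 0 ≤ K) (hA : ∀ i j, Measurable fun ω => A ω i j)
    (hsub : IsJointlySubgaussian μ (fun ω (p : m × n) => A ω p.1 p.2) K) :
    ∫⁻ ω, ENNReal.ofReal (Real.exp (t * ‖A ω‖ / 4)) ∂μ ≤
      ENNReal.ofReal (8 ^ (Fintype.card m + Fintype.card n) * Real.exp (16 * K * t ^ 2)) := by
  set V := volume (ball (0 : EuclideanSpace ℝ m) (1 / 4)) *
    volume (ball (0 : EuclideanSpace ℝ n) (1 / 4)) with hV
  have hV0 : V ≠ 0 := mul_ne_zero (Metric.measure_ball_pos _ _ (by norm_num)).ne'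
    (Metric.measure_ball_pos _ _ (by norm_num)).ne'
  have hVtop : V ≠ ⊤ := ENNReal.mul_ne_top measure_ball_lt_top.ne measure_ball_lt_top.ne
  have hmeas : Measurable fun q : Ω × (EuclideanSpace ℝ m × EuclideanSpace ℝ n) =>
      ENNReal.ofReal (Real.exp (t * inner ℝ q.2.1 ((A q.1).toEuclideanLin q.2.2))) := by
    simp only [inner_toEuclideanLin]
    refine ENNReal.measurable_ofReal.comp (Real.measurable_exp.comp (measurable_const.mul ?_))
    refine Finset.measurable_sum _ fun i _ => Finset.measurable_sum _ fun j _ => ?_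
    refine Measurable.mul (Measurable.mul ?_ ?_) ((hA i j).comp measurable_fst)
    · exact (EuclideanSpace.proj (𝕜 := ℝ) i).continuous.measurable.comp
        (measurable_fst.comp measurable_snd)
    · exact (EuclideanSpace.proj (𝕜 := ℝ) j).continuous.measurable.comp
        (measurable_snd.comp measurable_snd)
  rw [← ENNReal.mul_le_mul_iff_left hV0 hVtop]
  calc (∫⁻ ω, ENNReal.ofReal (Real.exp (t * ‖A ω‖ / 4)) ∂μ) * V
      = ∫⁻ ω, ENNReal.ofReal (Real.exp (t * ‖A ω‖ / 4)) * V ∂μ :=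
        (lintegral_mul_const' _ _ hVtop).symm
    _ ≤ ∫⁻ ω, (∫⁻ p in ball (0 : EuclideanSpace ℝ m) 2 ×ˢ ball (0 : EuclideanSpace ℝ n) 2,
          ENNReal.ofReal (Real.exp (t * inner ℝ p.1 ((A ω).toEuclideanLin p.2)))) ∂μ :=
        lintegral_mono fun ω => exp_norm_mul_volume_le (A ω) ht
    _ = ∫⁻ p in ball (0 : EuclideanSpace ℝ m) 2 ×ˢ ball (0 : EuclideanSpace ℝ n) 2,
          (∫⁻ ω, ENNReal.ofReal (Real.exp (t * inner ℝ p.1 ((A ω).toEuclideanLin p.2))) ∂μ) :=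
        lintegral_lintegral_swap hmeas.aemeasurable
    _ ≤ ∫⁻ _p in ball (0 : EuclideanSpace ℝ m) 2 ×ˢ ball (0 : EuclideanSpace ℝ n) 2,
          ENNReal.ofReal (Real.exp (16 * K * t ^ 2)) := by
        refine setLIntegral_mono' (Metric.isOpen_ball.measurableSet.prod
          Metric.isOpen_ball.measurableSet) fun p hp => ?_
        have hp1 : ‖p.1‖ ≤ 2 := (mem_ball_zero_iff.1 hp.1).le
        have hp2 : ‖p.2‖ ≤ 2 := (mem_ball_zero_iff.1 hp.2).le
        have h := hsub fun q => t * (p.1 q.1 * p.2 q.2)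
        have e1 : ∀ ω, ∑ q : m × n, t * (p.1 q.1 * p.2 q.2) * A ω q.1 q.2
            = t * inner ℝ p.1 ((A ω).toEuclideanLin p.2) := by
          intro ω
          rw [inner_toEuclideanLin, Fintype.sum_prod_type, Finset.mul_sum]
          refine Finset.sum_congr rfl fun i _ => ?_
          rw [Finset.mul_sum]
          exact Finset.sum_congr rfl fun j _ => by ring
        have e2 : ∑ q : m × n, (t * (p.1 q.1 * p.2 q.2)) ^ 2 = t ^ 2 * (‖p.1‖ ^ 2 * ‖p.2‖ ^ 2) := by
          rw [EuclideanSpace.norm_sq_eq, EuclideanSpace.norm_sq_eq, Fintype.sum_prod_type,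
            Finset.sum_mul_sum, Finset.mul_sum]
          refine Finset.sum_congr rfl fun i _ => ?_
          rw [Finset.mul_sum]
          refine Finset.sum_congr rfl fun j _ => ?_
          simp only [Real.norm_eq_abs, sq_abs]
          ring
        simp only [e1] at h
        rw [e2] at h
        refine h.trans (ENNReal.ofReal_le_ofReal (Real.exp_le_exp.2 ?_))
        calc K * (t ^ 2 * (‖p.1‖ ^ 2 * ‖p.2‖ ^ 2)) ≤ K * (t ^ 2 * (2 ^ 2 * 2 ^ 2)) := by gcongr
          _ = 16 * K * t ^ 2 := by ring
    _ = ENNReal.ofReal (8 ^ (Fintype.card m + Fintype.card n) * Real.exp (16 * K * t ^ 2)) * V := by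
        rw [setLIntegral_const, Measure.volume_eq_prod, Measure.prod_prod, volume_ball_two,
          volume_ball_two, pow_add, ENNReal.ofReal_mul (by positivity),
          ENNReal.ofReal_mul (by positivity), hV]
        ring

lemma sq_le_add_exp_sub {x y : ℝ} (hy : 0 ≤ y) :
    y ^ 2 ≤ 4 * x ^ 2 + 8 * Real.exp (y - x) := by
  rcases le_total y (2 * x) with h | h
  · have : y ^ 2 ≤ (2 * x) ^ 2 := by gcongr
    nlinarith [Real.exp_pos (y - x)]
  · have h1 := Real.quadratic_le_exp_of_nonneg (x := y / 2) (by positivity)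
    have h2 : Real.exp (y / 2) ≤ Real.exp (y - x) := Real.exp_le_exp.2 (by linarith)
    nlinarith [sq_nonneg x]

/-- The operator norm of a matrix with jointly sub-Gaussian entries is of the order of the square
root of the larger dimension, without logarithmic loss. -/
lemma lintegral_norm_sq_le [IsProbabilityMeasure μ] {A : Ω → Matrix m n ℝ} {K : ℝ} {q : ℕ}
    (hK : 0 < K) (hq : 1 ≤ q) (hm : Fintype.card m ≤ q) (hn : Fintype.card n ≤ q)
    (hA : ∀ i j, Measurable fun ω => A ω i j)
    (hsub : IsJointlySubgaussian μ (fun ω (p : m × n) => A ω p.1 p.2) K) :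
    ∫⁻ ω, ENNReal.ofReal (‖A ω‖ ^ 2) ∂μ ≤ ENNReal.ofReal (31104 * K * q) := by
  have hq' : (1 : ℝ) ≤ q := by exact_mod_cast hq
  have hq0 : (0 : ℝ) < q := by linarith
  -- The exponent `t` balances the volume factor `8 ^ (2 * q)` against `exp (16 * K * t ^ 2)`.
  set t := √(q / K) with ht
  have ht2 : t ^ 2 = q / K := Real.sq_sqrt (by positivity)
  have ht0 : 0 < t := Real.sqrt_pos.2 (by positivity)
  have hexp := lintegral_exp_norm_le (μ := μ) ht0.le hK.le hA hsub
  have hbound : (8 : ℝ) ^ (Fintype.card m + Fintype.card n) * Real.exp (16 * K * t ^ 2) ≤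
      Real.exp (22 * q) := by
    have e8 : (8 : ℝ) ≤ Real.exp 3 := by
      have := Real.exp_one_gt_d9
      have h3 : Real.exp 3 = Real.exp 1 ^ 3 := by rw [← Real.exp_nat_mul]; norm_num
      rw [h3]
      calc (8 : ℝ) = 2 ^ 3 := by norm_num
        _ ≤ _ := by gcongr; linarith
    calc (8 : ℝ) ^ (Fintype.card m + Fintype.card n) * Real.exp (16 * K * t ^ 2)
        ≤ 8 ^ (2 * q) * Real.exp (16 * q) := by
          have : 16 * K * t ^ 2 = 16 * q := by rw [ht2]; field_simp
          rw [this]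
          gcongr
          · norm_num
          · omega
      _ ≤ Real.exp 3 ^ (2 * q) * Real.exp (16 * q) := by gcongr
      _ = Real.exp (22 * q) := by
          rw [← Real.exp_nat_mul, ← Real.exp_add]
          congr 1
          push_cast
          ring
  replace hexp := hexp.trans (ENNReal.ofReal_le_ofReal hbound)
  have hpt : ∀ ω, ENNReal.ofReal (‖A ω‖ ^ 2) ≤ ENNReal.ofReal (16 * K / q * (4 * (22 * q) ^ 2)) +
      ENNReal.ofReal (16 * K / q * (8 * Real.exp (-(22 * q)))) *
        ENNReal.ofReal (Real.exp (t * ‖A ω‖ / 4)) := by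
    intro ω
    rw [← ENNReal.ofReal_mul (by positivity), ← ENNReal.ofReal_add (by positivity) (by positivity)]
    refine ENNReal.ofReal_le_ofReal ?_
    have h := sq_le_add_exp_sub (x := 22 * (q : ℝ)) (y := t * ‖A ω‖ / 4) (by positivity)
    have e : ‖A ω‖ ^ 2 = 16 * K / q * (t * ‖A ω‖ / 4) ^ 2 := by
      rw [div_pow, mul_pow, ht2]; field_simp; norm_num
    calc ‖A ω‖ ^ 2 = 16 * K / q * (t * ‖A ω‖ / 4) ^ 2 := e
      _ ≤ 16 * K / q * (4 * (22 * q) ^ 2 + 8 * Real.exp (t * ‖A ω‖ / 4 - 22 * q)) := by gcongr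
      _ = _ := by rw [sub_eq_neg_add, Real.exp_add]; ring
  calc _ ≤ _ := lintegral_mono hpt
    _ = ENNReal.ofReal (16 * K / q * (4 * (22 * q) ^ 2)) +
        ENNReal.ofReal (16 * K / q * (8 * Real.exp (-(22 * q)))) *
          ∫⁻ ω, ENNReal.ofReal (Real.exp (t * ‖A ω‖ / 4)) ∂μ := by
        rw [lintegral_add_left measurable_const, lintegral_const, measure_univ, mul_one,
          lintegral_const_mul' _ _ ENNReal.ofReal_ne_top]
    _ ≤ ENNReal.ofReal (16 * K / q * (4 * (22 * q) ^ 2)) +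
        ENNReal.ofReal (16 * K / q * (8 * Real.exp (-(22 * q)))) *
          ENNReal.ofReal (Real.exp (22 * q)) := by gcongr
    _ ≤ ENNReal.ofReal (31104 * K * q) := by
        rw [← ENNReal.ofReal_mul (by positivity), ← ENNReal.ofReal_add (by positivity)
          (by positivity)]
        refine ENNReal.ofReal_le_ofReal ?_
        have e : Real.exp (-(22 * (q : ℝ))) * Real.exp (22 * q) = 1 := by
          rw [← Real.exp_add]; simp
        calc _ = 16 * K / q * (4 * (22 * q) ^ 2)
              + 16 * K / q * 8 * (Real.exp (-(22 * (q : ℝ))) * Real.exp (22 * q)) := by ring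
          _ = 16 * K / q * (4 * (22 * q) ^ 2 + 8 * 1) := by rw [e]; ring
          _ ≤ 16 * K / q * (4 * (22 * q) ^ 2 + 8 * q ^ 2) := by gcongr; nlinarith
          _ = 31104 * K * q := by field_simp; norm_num

lemma integral_norm_sq_le [IsProbabilityMeasure μ] {A : Ω → Matrix m n ℝ} {K : ℝ} {q : ℕ}
    (hK : 0 < K) (hq : 1 ≤ q) (hm : Fintype.card m ≤ q) (hn : Fintype.card n ≤ q)
    (hA : ∀ i j, Measurable fun ω => A ω i j)
    (hsub : IsJointlySubgaussian μ (fun ω (p : m × n) => A ω p.1 p.2) K) :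
    Integrable (fun ω => ‖A ω‖ ^ 2) μ ∧ ∫ ω, ‖A ω‖ ^ 2 ∂μ ≤ 31104 * K * q := by
  have hle := lintegral_norm_sq_le (μ := μ) hK hq hm hn hA hsub
  have hmeas : Measurable fun ω => ‖A ω‖ ^ 2 :=
    (continuous_l2_opNorm.measurable.comp
      (measurable_pi_lambda (fun ω i j => A ω i j)
        fun i => measurable_pi_lambda _ fun j => hA i j)).pow_const 2
  constructor
  · refine ⟨hmeas.aestronglyMeasurable, ?_⟩
    rw [hasFiniteIntegral_iff_ofReal (Filter.Eventually.of_forall fun ω => by positivity)]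
    exact hle.trans_lt ENNReal.ofReal_lt_top
  · rw [integral_eq_lintegral_of_nonneg_ae (Filter.Eventually.of_forall fun ω => by positivity)
      hmeas.aestronglyMeasurable]
    exact ENNReal.toReal_le_of_le_ofReal (by positivity) hle

end OperatorNorm

/-! ### Moment generating functions of sub-Gaussian and of masked noise -/

section SubGaussian

variable {Ω : Type*} [MeasurableSpace Ω] {μ : Measure Ω}

lemma eLpNorm_le_of_psiTwoNorm_le {X : Ω → ℝ} {γ : ℝ} (hγ : 0 ≤ γ)
    (h : psiTwoNorm μ X ≤ ENNReal.ofReal γ) {p : ℝ} (hp : 1 ≤ p) :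
    eLpNorm X (ENNReal.ofReal p) μ ≤ ENNReal.ofReal (γ * √p) := by
  have h1 := (le_iSup (fun p : {p : ℝ // 1 ≤ p} =>
    eLpNorm X (ENNReal.ofReal p) μ / ENNReal.ofReal √(p : ℝ)) ⟨p, hp⟩).trans h
  have h0 : 0 < √p := Real.sqrt_pos.2 (by linarith)
  rw [ENNReal.div_le_iff (by simpa using h0) ENNReal.ofReal_ne_top] at h1
  rwa [ENNReal.ofReal_mul hγ]

lemma lintegral_pow_le_of_psiTwoNorm_le {X : Ω → ℝ} {γ : ℝ} (hγ : 0 ≤ γ)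
    (h : psiTwoNorm μ X ≤ ENNReal.ofReal γ) {j : ℕ} (hj : 1 ≤ j) :
    ∫⁻ ω, ENNReal.ofReal ((X ω ^ 2) ^ j) ∂μ ≤ ENNReal.ofReal ((γ ^ 2 * (2 * j)) ^ j) := by
  have hj' : (1 : ℝ) ≤ j := by exact_mod_cast hj
  have hp : (0 : ℝ) < 2 * j := by linarith
  have h1 := eLpNorm_le_of_psiTwoNorm_le hγ h (p := 2 * j) (by linarith)
  rw [eLpNorm_eq_lintegral_rpow_enorm_toReal (by simpa using Nat.ne_of_gt hj) ENNReal.ofReal_ne_top,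
    ENNReal.toReal_ofReal hp.le, one_div, ENNReal.rpow_inv_le_iff hp] at h1
  calc _ = ∫⁻ ω, ‖X ω‖ₑ ^ (2 * (j : ℝ)) ∂μ := by
        refine lintegral_congr fun ω => ?_
        have : (2 * (j : ℝ)) = ((2 * j : ℕ) : ℝ) := by push_cast; ring
        rw [this, ENNReal.rpow_natCast, ← ofReal_norm,
          ← ENNReal.ofReal_pow (norm_nonneg _), pow_mul, Real.norm_eq_abs, sq_abs]
    _ ≤ _ := h1
    _ = _ := by
        have : (2 * (j : ℝ)) = ((2 * j : ℕ) : ℝ) := by push_cast; ring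
        rw [this, ENNReal.rpow_natCast, ← ENNReal.ofReal_pow (by positivity), pow_mul, mul_pow γ,
          Real.sq_sqrt (by positivity)]

/-- The even moments, compared with the exponential series by means of `j ^ j / j! ≤ exp j`,
control the exponential moments of the square. -/
lemma lintegral_exp_sq_le [IsProbabilityMeasure μ] {X : Ω → ℝ} {γ s : ℝ} (hX : Measurable X)
    (hγ : 0 ≤ γ) (h : psiTwoNorm μ X ≤ ENNReal.ofReal γ) (hs : 0 ≤ s)
    (hsγ : 12 * γ ^ 2 * s ≤ 1) :
    ∫⁻ ω, ENNReal.ofReal (Real.exp (s * X ω ^ 2)) ∂μ ≤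
      ENNReal.ofReal (Real.exp (12 * γ ^ 2 * s)) := by
  set x := 6 * γ ^ 2 * s with hx
  have hx0 : 0 ≤ x := by positivity
  have hx1 : x ≤ 1 / 2 := by rw [hx]; linarith
  have hexp : ∀ y : ℝ, 0 ≤ y →
      ENNReal.ofReal (Real.exp y) = ∑' j : ℕ, ENNReal.ofReal (y ^ j / j.factorial) := by
    intro y hy
    rw [← ENNReal.ofReal_tsum_of_nonneg (fun j => by positivity)
      (Real.summable_pow_div_factorial y), Real.exp_eq_exp_ℝ, NormedSpace.exp_eq_tsum_div]
  have hterm : ∀ j : ℕ, ∫⁻ ω, ENNReal.ofReal ((s * X ω ^ 2) ^ j / j.factorial) ∂μ ≤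
      ENNReal.ofReal (x ^ j) := by
    intro j
    rcases Nat.eq_zero_or_pos j with rfl | hj
    · simp
    have e : ∀ ω, ENNReal.ofReal ((s * X ω ^ 2) ^ j / j.factorial) =
        ENNReal.ofReal (s ^ j / j.factorial) * ENNReal.ofReal ((X ω ^ 2) ^ j) := by
      intro ω
      rw [← ENNReal.ofReal_mul (by positivity), mul_pow]
      congr 1
      ring
    simp only [e]
    rw [lintegral_const_mul' _ _ ENNReal.ofReal_ne_top]
    refine (mul_le_mul_right (lintegral_pow_le_of_psiTwoNorm_le hγ h hj) _).trans ?_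
    rw [← ENNReal.ofReal_mul (by positivity)]
    refine ENNReal.ofReal_le_ofReal ?_
    have e3 : Real.exp (j : ℝ) ≤ 3 ^ j := by
      rw [← Real.exp_one_pow]
      gcongr
      linarith [Real.exp_one_lt_d9]
    have hfac := (Real.pow_div_factorial_le_exp (j : ℝ) (by positivity) j).trans e3
    calc _ = (2 * γ ^ 2 * s) ^ j * ((j : ℝ) ^ j / j.factorial) := by
          simp only [mul_pow]; ring
      _ ≤ (2 * γ ^ 2 * s) ^ j * 3 ^ j := by gcongr
      _ = x ^ j := by rw [← mul_pow, hx]; ring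
  calc _ = ∑' j : ℕ, ∫⁻ ω, ENNReal.ofReal ((s * X ω ^ 2) ^ j / j.factorial) ∂μ := by
        rw [← lintegral_tsum fun j => by fun_prop]
        exact lintegral_congr fun ω => hexp _ (by positivity)
    _ ≤ ∑' j : ℕ, ENNReal.ofReal (x ^ j) := ENNReal.tsum_le_tsum hterm
    _ = ENNReal.ofReal (1 - x)⁻¹ := by
        rw [← ENNReal.ofReal_tsum_of_nonneg (fun j => by positivity)
          (summable_geometric_of_lt_one hx0 (by linarith)),
          tsum_geometric_of_lt_one hx0 (by linarith)]
    _ ≤ _ := by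
        refine ENNReal.ofReal_le_ofReal ?_
        have h1 : 1 + 2 * x ≤ Real.exp (12 * γ ^ 2 * s) := by
          have := Real.add_one_le_exp (12 * γ ^ 2 * s)
          rw [hx]; linarith
        refine le_trans ?_ h1
        rw [inv_le_iff_one_le_mul₀ (by linarith)]
        nlinarith

lemma exp_le_add_exp_sq (x : ℝ) : Real.exp x ≤ x + Real.exp (x ^ 2) := by
  have h1 := Real.add_one_le_exp (x ^ 2)
  rcases le_total |x| 1 with h | h
  · have := (abs_le.1 (Real.abs_exp_sub_one_sub_id_le h)).2
    linarith
  rcases le_total 0 x with h0 | h0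
  · rw [abs_of_nonneg h0] at h
    have : Real.exp x ≤ Real.exp (x ^ 2) := Real.exp_le_exp.2 (by nlinarith)
    linarith
  · rw [abs_of_nonpos h0] at h
    have : Real.exp x ≤ 1 := Real.exp_le_one_iff.2 h0
    nlinarith

lemma integrable_exp_of_lintegral_lt_top {Y : Ω → ℝ} (hY : Measurable Y)
    (h : ∫⁻ ω, ENNReal.ofReal (Real.exp (Y ω)) ∂μ < ⊤) :
    Integrable (fun ω => Real.exp (Y ω)) μ := by
  refine ⟨(Real.measurable_exp.comp hY).aestronglyMeasurable, ?_⟩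
  rwa [hasFiniteIntegral_iff_ofReal (Filter.Eventually.of_forall fun ω => (Real.exp_pos _).le)]

lemma integral_exp_le_of_lintegral_le {Y : Ω → ℝ} {b : ℝ} (hY : Measurable Y)
    (h : ∫⁻ ω, ENNReal.ofReal (Real.exp (Y ω)) ∂μ ≤ ENNReal.ofReal (Real.exp b)) :
    ∫ ω, Real.exp (Y ω) ∂μ ≤ Real.exp b := by
  rw [integral_eq_lintegral_of_nonneg_ae (Filter.Eventually.of_forall fun ω => (Real.exp_pos _).le)
    (Real.measurable_exp.comp hY).aestronglyMeasurable]
  exact ENNReal.toReal_le_of_le_ofReal (Real.exp_pos _).le h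

/-- A centred random variable with finite sub-Gaussian norm has a sub-Gaussian moment generating
function. Small exponents use `exp x ≤ x + exp (x ^ 2)` and the vanishing mean, large exponents
use `t * x ≤ s * x ^ 2 + t ^ 2 / (4 * s)`. -/
lemma hasSubgaussianMGF_of_psiTwoNorm_le [IsProbabilityMeasure μ] {X : Ω → ℝ} {γ : ℝ}
    (hX : Measurable X) (hγ : 0 < γ) (h : psiTwoNorm μ X ≤ ENNReal.ofReal γ)
    (h0 : ∫ ω, X ω ∂μ = 0) :
    HasSubgaussianMGF X (Real.toNNReal (30 * γ ^ 2)) μ := by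
  -- The largest exponent that `lintegral_exp_sq_le` allows.
  set s := (12 * γ ^ 2)⁻¹ with hs
  have hs0 : 0 < s := by positivity
  have hsq := lintegral_exp_sq_le hX hγ.le h hs0.le (by rw [hs]; field_simp; rfl)
  have hone : 12 * γ ^ 2 * s = 1 := by rw [hs]; field_simp
  rw [hone] at hsq
  have hle : ∀ t x : ℝ, t * x ≤ s * x ^ 2 + 3 * γ ^ 2 * t ^ 2 := by
    intro t x
    have e : s * x ^ 2 + 3 * γ ^ 2 * t ^ 2 - t * x = s * (x - 6 * γ ^ 2 * t) ^ 2 := by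
      rw [hs]; field_simp; ring
    nlinarith [mul_nonneg hs0.le (sq_nonneg (x - 6 * γ ^ 2 * t))]
  have hbig : ∀ t : ℝ, ∫⁻ ω, ENNReal.ofReal (Real.exp (t * X ω)) ∂μ ≤
      ENNReal.ofReal (Real.exp (1 + 3 * γ ^ 2 * t ^ 2)) := by
    intro t
    calc _ ≤ ∫⁻ ω, ENNReal.ofReal (Real.exp (3 * γ ^ 2 * t ^ 2)) *
          ENNReal.ofReal (Real.exp (s * X ω ^ 2)) ∂μ := by
          refine lintegral_mono fun ω => ?_
          rw [← ENNReal.ofReal_mul (Real.exp_pos _).le, ← Real.exp_add]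
          refine ENNReal.ofReal_le_ofReal (Real.exp_le_exp.2 ?_)
          linarith [hle t (X ω)]
      _ ≤ ENNReal.ofReal (Real.exp (3 * γ ^ 2 * t ^ 2)) * ENNReal.ofReal (Real.exp 1) := by
          rw [lintegral_const_mul' _ _ ENNReal.ofReal_ne_top]
          gcongr
      _ = _ := by
          rw [← ENNReal.ofReal_mul (Real.exp_pos _).le, ← Real.exp_add, add_comm]
  have hint : ∀ t : ℝ, Integrable (fun ω => Real.exp (t * X ω)) μ := fun t =>
    integrable_exp_of_lintegral_lt_top (hX.const_mul t)
      ((hbig t).trans_lt ENNReal.ofReal_lt_top)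
  refine ⟨hint, fun t => ?_⟩
  have hgoal : ((Real.toNNReal (30 * γ ^ 2) : NNReal) : ℝ) * t ^ 2 / 2 = 15 * γ ^ 2 * t ^ 2 := by
    rw [Real.coe_toNNReal _ (by positivity)]; ring
  rw [hgoal]
  unfold mgf
  rcases le_total (12 * γ ^ 2 * t ^ 2) 1 with ht | ht
  · have hsm := lintegral_exp_sq_le hX hγ.le h (sq_nonneg t) ht
    have hm : Measurable fun ω => t ^ 2 * X ω ^ 2 := by fun_prop
    have hi := integrable_exp_of_lintegral_lt_top hm (hsm.trans_lt ENNReal.ofReal_lt_top)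
    have hXi : Integrable X μ := by
      refine MemLp.integrable (q := ENNReal.ofReal 1) (by simp) ⟨hX.aestronglyMeasurable, ?_⟩
      exact (eLpNorm_le_of_psiTwoNorm_le hγ.le h le_rfl).trans_lt ENNReal.ofReal_lt_top
    calc ∫ ω, Real.exp (t * X ω) ∂μ ≤ ∫ ω, (t * X ω + Real.exp (t ^ 2 * X ω ^ 2)) ∂μ := by
          refine integral_mono (hint t) ((hXi.const_mul t).add hi) fun ω => ?_
          have := exp_le_add_exp_sq (t * X ω)
          rwa [mul_pow] at this
      _ = ∫ ω, Real.exp (t ^ 2 * X ω ^ 2) ∂μ := by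
          rw [integral_add (hXi.const_mul t) hi, integral_const_mul, h0, mul_zero, zero_add]
      _ ≤ Real.exp (12 * γ ^ 2 * t ^ 2) := integral_exp_le_of_lintegral_le hm hsm
      _ ≤ _ := Real.exp_le_exp.2 (by nlinarith [mul_nonneg (sq_nonneg γ) (sq_nonneg t)])
  · refine (integral_exp_le_of_lintegral_le (hX.const_mul t) (hbig t)).trans ?_
    exact Real.exp_le_exp.2 (by linarith)

lemma integrable_sq_of_psiTwoNorm_le [IsProbabilityMeasure μ] {X : Ω → ℝ} {γ : ℝ}
    (hX : Measurable X) (hγ : 0 ≤ γ) (h : psiTwoNorm μ X ≤ ENNReal.ofReal γ) :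
    Integrable (fun ω => X ω ^ 2) μ ∧ ∫ ω, X ω ^ 2 ∂μ ≤ 2 * γ ^ 2 := by
  have h1 := lintegral_pow_le_of_psiTwoNorm_le hγ h (j := 1) le_rfl
  simp only [pow_one, Nat.cast_one, mul_one] at h1
  have hm : Measurable fun ω => X ω ^ 2 := by fun_prop
  constructor
  · refine ⟨hm.aestronglyMeasurable, ?_⟩
    rw [hasFiniteIntegral_iff_ofReal (Filter.Eventually.of_forall fun ω => sq_nonneg _)]
    exact h1.trans_lt ENNReal.ofReal_lt_top
  · rw [integral_eq_lintegral_of_nonneg_ae (Filter.Eventually.of_forall fun ω => sq_nonneg _)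
      hm.aestronglyMeasurable, mul_comm]
    exact ENNReal.toReal_le_of_le_ofReal (by positivity) h1

lemma lintegral_exp_mul_le_of_hasSubgaussianMGF {Y : Ω → ℝ} {c : NNReal}
    (h : HasSubgaussianMGF Y c μ) (t : ℝ) :
    ∫⁻ ω, ENNReal.ofReal (Real.exp (t * Y ω)) ∂μ ≤ ENNReal.ofReal (Real.exp (c * t ^ 2 / 2)) := by
  rw [← ofReal_integral_eq_lintegral_ofReal (h.integrable_exp_mul t)
    (Filter.Eventually.of_forall fun ω => (Real.exp_pos _).le)]
  exact ENNReal.ofReal_le_ofReal (h.mgf_le t)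

variable {ι : Type*} [Fintype ι]

lemma hasSubgaussianMGF_sum_const_mul {Y : ι → Ω → ℝ} {c : NNReal} (hind : iIndepFun Y μ)
    (h : ∀ i, HasSubgaussianMGF (Y i) c μ) (a : ι → ℝ) :
    HasSubgaussianMGF (fun ω => ∑ i, a i * Y i ω) (∑ i, Real.toNNReal (a i ^ 2) * c) μ := by
  refine HasSubgaussianMGF.sum_of_iIndepFun (X := fun i ω => a i * Y i ω)
    (hind.comp (fun i x => a i * x) fun i => measurable_const_mul _) fun i _ => ?_
  have := (h i).const_mul (a i)
  rwa [Real.toNNReal_of_nonneg (sq_nonneg _)]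

lemma IsJointlySubgaussian.comp_equiv {κ : Type*} [Fintype κ] {X : Ω → ι → ℝ} {K : ℝ}
    (h : IsJointlySubgaussian μ X K) (e : κ ≃ ι) :
    IsJointlySubgaussian μ (fun ω i => X ω (e i)) K := by
  intro a
  have h1 := h fun i => a (e.symm i)
  have e1 : ∀ ω, ∑ i, a (e.symm i) * X ω i = ∑ i, a i * X ω (e i) := fun ω => by
    rw [← e.sum_comp]; simp
  have e2 : ∑ i, a (e.symm i) ^ 2 = ∑ i, a i ^ 2 := e.symm.sum_comp fun i => a i ^ 2
  simpa only [e1, e2] using h1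

/-- The indicator of a revealed entry. -/
def reveal (b : Bool) : ℝ := if b = true then 1 else 0

lemma measurable_reveal : Measurable reveal := Measurable.of_discrete

lemma reveal_mem_Icc (b : Bool) : reveal b ∈ Set.Icc (0 : ℝ) 1 := by
  cases b <;> simp [reveal]

variable {η : ι → Ω → ℝ} {B : ι → Ω → Bool} {ρ F : ℝ} {c : NNReal} {f : ι → ℝ}

lemma integral_reveal [IsProbabilityMeasure μ] {b : Ω → Bool} (hb : Measurable b) (hρ : 0 ≤ ρ)
    (h : μ {ω | b ω = true} = ENNReal.ofReal ρ) : ∫ ω, reveal (b ω) ∂μ = ρ := by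
  have e : (fun ω => reveal (b ω)) = Set.indicator {ω | b ω = true} 1 := by
    ext ω
    by_cases h : b ω = true <;> simp [reveal, h]
  rw [e, integral_indicator_one (s := {ω | b ω = true}) (hb (MeasurableSet.singleton true)),
    Measure.real, h,
    ENNReal.toReal_ofReal hρ]

lemma hasSubgaussianMGF_reveal [IsProbabilityMeasure μ] {b : Ω → Bool} (hb : Measurable b)
    (hρ : 0 ≤ ρ) (h : μ {ω | b ω = true} = ENNReal.ofReal ρ) :
    HasSubgaussianMGF (fun ω => reveal (b ω) - ρ) (1 / 4) μ := by
  have := hasSubgaussianMGF_of_mem_Icc (μ := μ) (X := fun ω => reveal (b ω)) (a := 0) (b := 1)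
    (measurable_reveal.comp hb).aemeasurable
    (Filter.Eventually.of_forall fun ω => reveal_mem_Icc _)
  rw [integral_reveal hb hρ h] at this
  convert this using 1
  norm_num

/-- Conditionally on the mask, the masked noise is a sum of independent sub-Gaussian variables. -/
lemma lintegral_exp_masked_noise_le [IsProbabilityMeasure μ] (hη : ∀ i, Measurable (η i))
    (hB : ∀ i, Measurable (B i)) (hind : iIndepFun η μ)
    (hindep : IndepFun (fun ω i => η i ω) (fun ω i => B i ω) μ)
    (hsub : ∀ i, HasSubgaussianMGF (η i) c μ) (a : ι → ℝ) (t : ℝ) :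
    ∫⁻ ω, ENNReal.ofReal (Real.exp (t * ∑ i, a i * (reveal (B i ω) * η i ω))) ∂μ ≤
      ENNReal.ofReal (Real.exp (c * t ^ 2 / 2 * ∑ i, a i ^ 2)) := by
  have hη' : Measurable fun ω i => η i ω := measurable_pi_lambda _ hη
  have hB' : Measurable fun ω i => B i ω := measurable_pi_lambda _ hB
  set g : (ι → ℝ) × (ι → Bool) → ENNReal := fun p =>
    ENNReal.ofReal (Real.exp (t * ∑ i, a i * (reveal (p.2 i) * p.1 i))) with hg
  have hgm : Measurable g := by
    refine ENNReal.measurable_ofReal.comp (Real.measurable_exp.comp (measurable_const.mul ?_))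
    refine Finset.measurable_sum _ fun i _ => measurable_const.mul (Measurable.mul ?_ ?_)
    · exact measurable_reveal.comp ((measurable_pi_apply i).comp measurable_snd)
    · exact (measurable_pi_apply i).comp measurable_fst
  have hpt : ∀ b : ι → Bool, ∫⁻ ω, g (fun i => η i ω, b) ∂μ ≤
      ENNReal.ofReal (Real.exp (c * t ^ 2 / 2 * ∑ i, a i ^ 2)) := by
    intro b
    have h := lintegral_exp_mul_le_of_hasSubgaussianMGF
      (hasSubgaussianMGF_sum_const_mul hind hsub fun i => a i * reveal (b i)) t
    simp only [mul_assoc] at h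
    refine h.trans (ENNReal.ofReal_le_ofReal (Real.exp_le_exp.2 ?_))
    have e : ((∑ i, Real.toNNReal ((a i * reveal (b i)) ^ 2) * c : NNReal) : ℝ)
        ≤ (∑ i, a i ^ 2) * c := by
      push_cast
      rw [Finset.sum_mul]
      refine Finset.sum_le_sum fun i _ => ?_
      rw [Real.coe_toNNReal _ (sq_nonneg _), mul_pow]
      have := reveal_mem_Icc (b i)
      refine mul_le_mul_of_nonneg_right (mul_le_of_le_one_right (sq_nonneg _) ?_) c.2
      exact pow_le_one₀ this.1 this.2
    calc _ ≤ (∑ i, a i ^ 2) * c * t ^ 2 / 2 := by gcongr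
      _ = _ := by ring
  calc _ = ∫⁻ p, g p ∂(μ.map fun ω => ((fun i => η i ω), fun i => B i ω)) :=
        (lintegral_map hgm (hη'.prodMk hB')).symm
    _ = ∫⁻ b, ∫⁻ e, g (e, b) ∂(μ.map fun ω i => η i ω) ∂(μ.map fun ω i => B i ω) := by
        have := Measure.isProbabilityMeasure_map (μ := μ) hη'.aemeasurable
        have := Measure.isProbabilityMeasure_map (μ := μ) hB'.aemeasurable
        rw [(indepFun_iff_map_prod_eq_prod_map_map hη'.aemeasurable hB'.aemeasurable).1 hindep,
          lintegral_prod_symm _ hgm.aemeasurable]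
    _ = ∫⁻ b, ∫⁻ ω, g (fun i => η i ω, b) ∂μ ∂(μ.map fun ω i => B i ω) :=
        lintegral_congr fun b => lintegral_map (hgm.comp measurable_prodMk_right) hη'
    _ ≤ ∫⁻ _b, ENNReal.ofReal (Real.exp (c * t ^ 2 / 2 * ∑ i, a i ^ 2))
          ∂(μ.map fun ω i => B i ω) := lintegral_mono hpt
    _ = _ := by
        rw [lintegral_const, Measure.map_apply hB' MeasurableSet.univ, Set.preimage_univ,
          measure_univ, mul_one]

/-- The centred data are jointly sub-Gaussian: the fluctuation of the mask and the masked noise are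
separated by `exp (x + y) ≤ (exp (2 * x) + exp (2 * y)) / 2`. -/
lemma isJointlySubgaussian_masked [IsProbabilityMeasure μ] (hη : ∀ i, Measurable (η i))
    (hB : ∀ i, Measurable (B i)) (hindη : iIndepFun η μ) (hindB : iIndepFun B μ)
    (hindep : IndepFun (fun ω i => η i ω) (fun ω i => B i ω) μ)
    (hsub : ∀ i, HasSubgaussianMGF (η i) c μ) (hρ : 0 ≤ ρ)
    (hprob : ∀ i, μ {ω | B i ω = true} = ENNReal.ofReal ρ) (hf : ∀ i, |f i| ≤ F) :
    IsJointlySubgaussian μ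
      (fun ω i => (reveal (B i ω) - ρ) * f i + reveal (B i ω) * η i ω) (F ^ 2 + 2 * c) := by
  intro a
  have hS0 : 0 ≤ ∑ i, a i ^ 2 := Finset.sum_nonneg fun i _ => sq_nonneg _
  have hmask := lintegral_exp_mul_le_of_hasSubgaussianMGF
    (hasSubgaussianMGF_sum_const_mul (Y := fun i ω => reveal (B i ω) - ρ)
      (hindB.comp (fun _ b => reveal b - ρ) fun _ => Measurable.of_discrete)
      (fun i => hasSubgaussianMGF_reveal (hB i) hρ (hprob i)) fun i => a i * f i) 2
  have hnoise := lintegral_exp_masked_noise_le hη hB hindη hindep hsub a 2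
  have hmask' : ((∑ i, Real.toNNReal ((a i * f i) ^ 2) * (1 / 4) : NNReal) : ℝ) * 2 ^ 2 / 2 ≤
      (F ^ 2 + 2 * c) * ∑ i, a i ^ 2 := by
    push_cast
    rw [← Finset.sum_mul]
    have : ∑ i, ((Real.toNNReal ((a i * f i) ^ 2) : NNReal) : ℝ) ≤ F ^ 2 * ∑ i, a i ^ 2 := by
      rw [Finset.mul_sum]
      refine Finset.sum_le_sum fun i _ => ?_
      rw [Real.coe_toNNReal _ (sq_nonneg _), mul_pow, mul_comm]
      exact mul_le_mul_of_nonneg_right (sq_le_sq' (abs_le.1 (hf i)).1 (abs_le.1 (hf i)).2)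
        (sq_nonneg _)
    nlinarith [mul_nonneg c.2 hS0, mul_nonneg (sq_nonneg F) hS0]
  have hnoise' : (c : ℝ) * 2 ^ 2 / 2 * ∑ i, a i ^ 2 ≤ (F ^ 2 + 2 * c) * ∑ i, a i ^ 2 := by
    nlinarith [mul_nonneg (sq_nonneg F) hS0]
  replace hmask := hmask.trans (ENNReal.ofReal_le_ofReal (Real.exp_le_exp.2 hmask'))
  replace hnoise := hnoise.trans (ENNReal.ofReal_le_ofReal (Real.exp_le_exp.2 hnoise'))
  have hconv : ∀ x y : ℝ, Real.exp (x + y) ≤ (Real.exp (2 * x) + Real.exp (2 * y)) / 2 := by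
    intro x y
    have e1 : Real.exp (2 * x) = Real.exp x ^ 2 := by rw [← Real.exp_nat_mul]; norm_num
    have e2 : Real.exp (2 * y) = Real.exp y ^ 2 := by rw [← Real.exp_nat_mul]; norm_num
    rw [Real.exp_add, e1, e2]
    nlinarith [sq_nonneg (Real.exp x - Real.exp y)]
  set P1 : Ω → ℝ := fun ω => ∑ i, a i * f i * (reveal (B i ω) - ρ) with hP1
  set P2 : Ω → ℝ := fun ω => ∑ i, a i * (reveal (B i ω) * η i ω) with hP2
  have hP1m : Measurable P1 := Finset.measurable_sum _ fun i _ =>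
    measurable_const.mul ((measurable_reveal.comp (hB i)).sub_const _)
  have hpt : ∀ ω, ENNReal.ofReal (Real.exp (∑ i, a i *
      ((reveal (B i ω) - ρ) * f i + reveal (B i ω) * η i ω))) ≤
      ENNReal.ofReal (1 / 2) * (ENNReal.ofReal (Real.exp (2 * P1 ω)) +
        ENNReal.ofReal (Real.exp (2 * P2 ω))) := by
    intro ω
    rw [← ENNReal.ofReal_add (Real.exp_pos _).le (Real.exp_pos _).le,
      ← ENNReal.ofReal_mul (by norm_num)]
    refine ENNReal.ofReal_le_ofReal ?_
    have e : ∑ i, a i * ((reveal (B i ω) - ρ) * f i + reveal (B i ω) * η i ω) = P1 ω + P2 ω := by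
      rw [hP1, hP2, ← Finset.sum_add_distrib]
      exact Finset.sum_congr rfl fun i _ => by ring
    rw [e]
    linarith [hconv (P1 ω) (P2 ω)]
  calc _ ≤ _ := lintegral_mono hpt
    _ = ENNReal.ofReal (1 / 2) * (∫⁻ ω, ENNReal.ofReal (Real.exp (2 * P1 ω)) ∂μ +
          ∫⁻ ω, ENNReal.ofReal (Real.exp (2 * P2 ω)) ∂μ) := by
        rw [lintegral_const_mul' _ _ ENNReal.ofReal_ne_top, lintegral_add_left (by fun_prop)]
    _ ≤ ENNReal.ofReal (1 / 2) * (ENNReal.ofReal (Real.exp ((F ^ 2 + 2 * c) * ∑ i, a i ^ 2)) +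
          ENNReal.ofReal (Real.exp ((F ^ 2 + 2 * c) * ∑ i, a i ^ 2))) := by gcongr
    _ = _ := by
        rw [← ENNReal.ofReal_add (Real.exp_pos _).le (Real.exp_pos _).le,
          ← ENNReal.ofReal_mul (by norm_num)]
        congr 1
        ring

end SubGaussian

/-! ### The number of revealed entries -/

section Revealed

variable {Ω : Type*} [MeasurableSpace Ω] {μ : Measure Ω} [IsProbabilityMeasure μ]
  {ι : Type*} [Fintype ι] {η : ι → Ω → ℝ} {B : ι → Ω → Bool} {ρ : ℝ}

lemma measureReal_sum_reveal_le (hB : ∀ i, Measurable (B i)) (hind : iIndepFun B μ) (hρ : 0 ≤ ρ)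
    (hprob : ∀ i, μ {ω | B i ω = true} = ENNReal.ofReal ρ) :
    μ.real {ω | ∑ i, reveal (B i ω) ≤ ρ * Fintype.card ι / 2} ≤
      Real.exp (-(ρ ^ 2 * Fintype.card ι / 2)) := by
  have h := HasSubgaussianMGF.measure_sum_ge_le_of_iIndepFun (μ := μ)
    (X := fun i ω => -(reveal (B i ω) - ρ)) (c := fun _ => 1 / 4) (s := Finset.univ)
    (ε := ρ * Fintype.card ι / 2)
    (hind.comp (fun _ b => -(reveal b - ρ)) fun _ => Measurable.of_discrete)
    (fun i _ => (hasSubgaussianMGF_reveal (hB i) hρ (hprob i)).neg) (by positivity)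
  have e : {ω | ρ * Fintype.card ι / 2 ≤ ∑ i, -(reveal (B i ω) - ρ)} =
      {ω | ∑ i, reveal (B i ω) ≤ ρ * Fintype.card ι / 2} := by
    ext ω
    simp only [Set.mem_ofPred_eq, Finset.sum_neg_distrib, Finset.sum_sub_distrib, Finset.sum_const,
      Finset.card_univ, nsmul_eq_mul]
    constructor <;> intro h <;> linarith
  rw [e] at h
  refine h.trans (Real.exp_le_exp.2 (le_of_eq ?_))
  simp only [Finset.sum_const, Finset.card_univ, nsmul_eq_mul]
  push_cast
  rcases eq_or_ne (Fintype.card ι : ℝ) 0 with h0 | h0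
  · simp [h0]
  · field_simp
    ring

lemma integral_sum_reveal_sub_sq_le (hB : ∀ i, Measurable (B i)) (hind : iIndepFun B μ)
    (hρ : 0 ≤ ρ) (hprob : ∀ i, μ {ω | B i ω = true} = ENNReal.ofReal ρ) :
    Integrable (fun ω => (∑ i, reveal (B i ω) - ρ * Fintype.card ι) ^ 2) μ ∧
      ∫ ω, (∑ i, reveal (B i ω) - ρ * Fintype.card ι) ^ 2 ∂μ ≤ Fintype.card ι / 4 := by
  have hm : ∀ i, Measurable fun ω => reveal (B i ω) := fun i => measurable_reveal.comp (hB i)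
  have hLp : ∀ i, MemLp (fun ω => reveal (B i ω)) 2 μ := fun i =>
    MemLp.of_bound (hm i).aestronglyMeasurable 1 (Filter.Eventually.of_forall fun ω => by
      have := reveal_mem_Icc (B i ω)
      rw [Real.norm_eq_abs, abs_of_nonneg this.1]
      exact this.2)
  have hsum : MemLp (fun ω => ∑ i, reveal (B i ω)) 2 μ := memLp_finsetSum _ fun i _ => hLp i
  refine ⟨(hsum.sub (memLp_const (ρ * Fintype.card ι))).integrable_sq, ?_⟩
  have hmean : ∫ ω, ∑ i, reveal (B i ω) ∂μ = ρ * Fintype.card ι := by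
    rw [integral_finsetSum _ fun i _ => (hLp i).integrable (by norm_num)]
    simp only [integral_reveal (hB _) hρ (hprob _), Finset.sum_const, Finset.card_univ,
      nsmul_eq_mul, mul_comm]
  have hvar : variance (∑ i, fun ω => reveal (B i ω)) μ =
      ∑ i, variance (fun ω => reveal (B i ω)) μ :=
    IndepFun.variance_sum (fun i _ => hLp i) fun i _ j _ hij =>
      (hind.comp (fun _ b => reveal b) fun _ => measurable_reveal).indepFun hij
  have hfun : (∑ i, fun ω => reveal (B i ω)) = fun ω => ∑ i, reveal (B i ω) := by
    ext ω; simp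
  rw [hfun, variance_eq_integral hsum.aemeasurable, hmean] at hvar
  rw [hvar]
  calc _ ≤ ∑ _i : ι, ((1 - 0) / 2 : ℝ) ^ 2 := Finset.sum_le_sum fun i _ =>
        variance_le_sq_of_bounded (Filter.Eventually.of_forall fun ω => reveal_mem_Icc _)
          (hm i).aemeasurable
    _ = _ := by
        rw [Finset.sum_const, Finset.card_univ, nsmul_eq_mul]; ring

/-- An event that depends only on the mask is independent of the noise. -/
lemma integral_indicator_sum_sq_le {γ : ℝ} {s : Set (ι → Bool)} (hη : ∀ i, Measurable (η i))
    (hB : ∀ i, Measurable (B i))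
    (hindep : IndepFun (fun ω i => η i ω) (fun ω i => B i ω) μ) (hγ : 0 ≤ γ)
    (hpsi : ∀ i, psiTwoNorm μ (η i) ≤ ENNReal.ofReal γ) :
    Integrable ({ω | (fun i => B i ω) ∈ s}.indicator fun ω => ∑ i, η i ω ^ 2) μ ∧
      ∫ ω, {ω | (fun i => B i ω) ∈ s}.indicator (fun ω => ∑ i, η i ω ^ 2) ω ∂μ ≤
        μ.real {ω | (fun i => B i ω) ∈ s} * (Fintype.card ι * (2 * γ ^ 2)) := by
  have hη' : Measurable fun ω i => η i ω := measurable_pi_lambda _ hη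
  have hB' : Measurable fun ω i => B i ω := measurable_pi_lambda _ hB
  have hs : MeasurableSet s := s.toFinite.measurableSet
  have hset : MeasurableSet {ω | (fun i => B i ω) ∈ s} := hB' hs
  have hi := fun i => integrable_sq_of_psiTwoNorm_le (hη i) hγ (hpsi i)
  have hint : Integrable (fun ω => ∑ i, η i ω ^ 2) μ := integrable_finsetSum _ fun i _ => (hi i).1
  refine ⟨hint.indicator hset, ?_⟩
  have hmul := hindep.integral_fun_comp_mul_comp (f := fun e : ι → ℝ => ∑ i, e i ^ 2)
    (g := s.indicator fun _ => (1 : ℝ)) hη'.aemeasurable hB'.aemeasurable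
    (Measurable.aestronglyMeasurable (by fun_prop))
    ((measurable_const.indicator hs).aestronglyMeasurable)
  have e1 : ∀ ω, (∑ i, η i ω ^ 2) * s.indicator (fun _ => (1 : ℝ)) (fun i => B i ω) =
      {ω | (fun i => B i ω) ∈ s}.indicator (fun ω => ∑ i, η i ω ^ 2) ω := by
    intro ω
    by_cases h : (fun i => B i ω) ∈ s <;> simp [Set.indicator, h]
  have e2 : ∫ ω, s.indicator (fun _ => (1 : ℝ)) (fun i => B i ω) ∂μ =
      μ.real {ω | (fun i => B i ω) ∈ s} := by
    rw [← integral_indicator_one hset]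
    rfl
  simp only [e1, e2] at hmul
  rw [hmul, mul_comm]
  refine mul_le_mul_of_nonneg_left ?_ measureReal_nonneg
  rw [integral_finsetSum _ fun i _ => (hi i).1]
  refine (Finset.sum_le_sum fun i _ => (hi i).2).trans (le_of_eq ?_)
  rw [Finset.sum_const, Finset.card_univ, nsmul_eq_mul]

end Revealed

/-! ### Deterministic error bounds -/

section Deterministic

open scoped Matrix.Norms.L2Operator

variable {m n : Type*} [Fintype m] [Fintype n]

lemma sum_sum_le_card_mul {g : m → n → ℝ} {b : ℝ} (h : ∀ i j, g i j ≤ b) :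
    ∑ i, ∑ j, g i j ≤ Fintype.card m * Fintype.card n * b := by
  calc _ ≤ ∑ _i : m, ∑ _j : n, b := by gcongr; exact h _ _
    _ = _ := by simp [mul_assoc]

/-- The error of the truncated decomposition, rescaled by an estimate `p ≥ ρ / 2` of `ρ`. -/
lemma sum_sq_error_le [DecidableEq n] {k : ℕ} {M A Z S : Matrix m n ℝ} {ρ p δ F : ℝ}
    (hρ : 0 < ρ) (hp : ρ / 2 ≤ p) (hk : 1 ≤ k) (hA : A.rank ≤ k)
    (hMA : ∀ i j, |M i j - A i j| ≤ δ) (hM : ∀ i j, |M i j| ≤ F)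
    (hS : IsTruncatedSVD k Z S) :
    ∑ i, ∑ j, (M i j - p⁻¹ * S i j) ^ 2 ≤
      8 / ρ ^ 2 * (32 * k * ‖Z - ρ • M‖ ^ 2 +
        34 * k * ρ ^ 2 * (Fintype.card m * Fintype.card n) * δ ^ 2 +
        (p - ρ) ^ 2 * (Fintype.card m * Fintype.card n) * F ^ 2) := by
  set D : ℝ := Fintype.card m * Fintype.card n with hD
  have hD0 : 0 ≤ D := by positivity
  have hp0 : 0 < p := by linarith
  have hk' : (1 : ℝ) ≤ k := by exact_mod_cast hk
  have hMA2 : ∑ i, ∑ j, (M i j - A i j) ^ 2 ≤ D * δ ^ 2 :=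
    sum_sum_le_card_mul fun i j => sq_le_sq' (abs_le.1 (hMA i j)).1 (abs_le.1 (hMA i j)).2
  have hM2 : ∑ i, ∑ j, M i j ^ 2 ≤ D * F ^ 2 :=
    sum_sum_le_card_mul fun i j => sq_le_sq' (abs_le.1 (hM i j)).1 (abs_le.1 (hM i j)).2
  have hrank : (ρ • A).rank ≤ k := by
    have h : ρ • A = A * (ρ • (1 : Matrix n n ℝ)) := by rw [Matrix.mul_smul, Matrix.mul_one]
    rw [h]
    exact (Matrix.rank_mul_le_left _ _).trans hA
  have hop : ‖Z - ρ • A‖ ^ 2 ≤ 2 * ‖Z - ρ • M‖ ^ 2 + 2 * (ρ ^ 2 * (D * δ ^ 2)) := by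
    have h1 : ‖Z - ρ • A‖ ≤ ‖Z - ρ • M‖ + ‖ρ • (M - A)‖ := by
      have := norm_add_le (Z - ρ • M) (ρ • M - ρ • A)
      rwa [sub_add_sub_cancel, ← smul_sub] at this
    have h2 : ‖ρ • (M - A)‖ ^ 2 ≤ ρ ^ 2 * (D * δ ^ 2) := by
      rw [norm_smul, mul_pow, Real.norm_eq_abs, sq_abs]
      gcongr
      exact (norm_sq_le_sum_sq (M - A)).trans hMA2
    have h3 : ‖Z - ρ • A‖ ^ 2 ≤ (‖Z - ρ • M‖ + ‖ρ • (M - A)‖) ^ 2 := by gcongr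
    nlinarith [sq_nonneg (‖Z - ρ • M‖ - ‖ρ • (M - A)‖)]
  have hSA : ∑ i, ∑ j, (S i j - ρ * A i j) ^ 2 ≤
      8 * k * (2 * ‖Z - ρ • M‖ ^ 2 + 2 * (ρ ^ 2 * (D * δ ^ 2))) := by
    refine (sum_sq_sub_le_of_isTruncatedSVD hS hrank).trans ?_
    gcongr
  have hpt : ∀ i j, (M i j - p⁻¹ * S i j) ^ 2 ≤ 2 * (p⁻¹) ^ 2 *
      (2 * ρ ^ 2 * (M i j - A i j) ^ 2 + 2 * (S i j - ρ * A i j) ^ 2 + (p - ρ) ^ 2 * M i j ^ 2) := by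
    intro i j
    have e : M i j - p⁻¹ * S i j =
        p⁻¹ * ((ρ * (M i j - A i j) - (S i j - ρ * A i j)) + (p - ρ) * M i j) := by
      field_simp; ring
    rw [e, mul_pow, mul_comm 2, mul_assoc]
    gcongr
    nlinarith [sq_nonneg ((ρ * (M i j - A i j) - (S i j - ρ * A i j)) - (p - ρ) * M i j),
      sq_nonneg (ρ * (M i j - A i j) + (S i j - ρ * A i j))]
  have hpinv : p⁻¹ ^ 2 ≤ 4 / ρ ^ 2 := by
    have : p⁻¹ ≤ (ρ / 2)⁻¹ := inv_anti₀ (by positivity) hp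
    calc p⁻¹ ^ 2 ≤ (ρ / 2)⁻¹ ^ 2 := by gcongr
      _ = 4 / ρ ^ 2 := by field_simp; norm_num
  calc _ ≤ ∑ i, ∑ j, 2 * (p⁻¹) ^ 2 * (2 * ρ ^ 2 * (M i j - A i j) ^ 2 +
        2 * (S i j - ρ * A i j) ^ 2 + (p - ρ) ^ 2 * M i j ^ 2) := by gcongr; exact hpt _ _
    _ = 2 * p⁻¹ ^ 2 * (2 * ρ ^ 2 * (∑ i, ∑ j, (M i j - A i j) ^ 2) +
        2 * (∑ i, ∑ j, (S i j - ρ * A i j) ^ 2) + (p - ρ) ^ 2 * ∑ i, ∑ j, M i j ^ 2) := by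
        simp only [Finset.mul_sum, ← Finset.sum_add_distrib]
    _ ≤ 2 * (4 / ρ ^ 2) * (2 * ρ ^ 2 * (D * δ ^ 2) +
        2 * (8 * k * (2 * ‖Z - ρ • M‖ ^ 2 + 2 * (ρ ^ 2 * (D * δ ^ 2)))) +
        (p - ρ) ^ 2 * (D * F ^ 2)) := by gcongr
    _ = 8 / ρ ^ 2 * (32 * k * ‖Z - ρ • M‖ ^ 2 + (2 + 32 * k) * (ρ ^ 2 * (D * δ ^ 2)) +
        (p - ρ) ^ 2 * D * F ^ 2) := by ring
    _ ≤ 8 / ρ ^ 2 * (32 * k * ‖Z - ρ • M‖ ^ 2 + (2 * k + 32 * k) * (ρ ^ 2 * (D * δ ^ 2)) +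
        (p - ρ) ^ 2 * D * F ^ 2) := by gcongr; linarith
    _ = _ := by ring

/-- The crude bound that is used when few entries are revealed. -/
lemma sum_sq_error_le_of_inv_card_le {k : ℕ} {M Z S : Matrix m n ℝ} {p F : ℝ} (hp0 : 0 < p)
    (hp : 1 ≤ p * (Fintype.card m * Fintype.card n))
    (hM : ∀ i j, |M i j| ≤ F) (hS : IsTruncatedSVD k Z S) :
    ∑ i, ∑ j, (M i j - p⁻¹ * S i j) ^ 2 ≤ 2 * (Fintype.card m * Fintype.card n) * F ^ 2 +
      2 * (Fintype.card m * Fintype.card n) ^ 2 * ∑ i, ∑ j, Z i j ^ 2 := by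
  set D : ℝ := Fintype.card m * Fintype.card n with hD
  have hM2 : ∑ i, ∑ j, M i j ^ 2 ≤ D * F ^ 2 :=
    sum_sum_le_card_mul fun i j => sq_le_sq' (abs_le.1 (hM i j)).1 (abs_le.1 (hM i j)).2
  have hpD : p⁻¹ ≤ D := (inv_le_iff_one_le_mul₀' hp0).2 hp
  calc _ ≤ ∑ i, ∑ j, (2 * M i j ^ 2 + 2 * p⁻¹ ^ 2 * S i j ^ 2) := by
        gcongr with i _ j _
        nlinarith [sq_nonneg (M i j + p⁻¹ * S i j)]
    _ = 2 * (∑ i, ∑ j, M i j ^ 2) + 2 * p⁻¹ ^ 2 * ∑ i, ∑ j, S i j ^ 2 := by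
        simp only [Finset.mul_sum, ← Finset.sum_add_distrib]
    _ ≤ 2 * (D * F ^ 2) + 2 * D ^ 2 * ∑ i, ∑ j, Z i j ^ 2 := by
        have hSZ := sum_sq_le_of_isTruncatedSVD hS
        exact add_le_add (by gcongr) (mul_le_mul (by gcongr) hSZ (by positivity) (by positivity))
    _ = _ := by ring

end Deterministic

/-! ### The expected error -/

section Expectation

open scoped Matrix.Norms.L2Operator

variable {Ω : Type*} [MeasurableSpace Ω] {μ : Measure Ω} [IsProbabilityMeasure μ]
  {m n ι : Type*} [Fintype m] [Fintype n] [DecidableEq n] [Fintype ι]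

lemma abs_max_one_sub_le {x y : ℝ} (hy : 1 ≤ y) : |max 1 x - y| ≤ |x - y| := by
  have := abs_max_sub_max_le_abs x y 1
  rwa [max_eq_left hy, max_comm] at this

/-- The squared error of the rescaled truncated decomposition is dominated by an integrable function
with small integral. The indicator in the dominating function is that of the event that at most
half of the expected number of entries are revealed. -/
lemma exists_integrable_error_bound (e : m × n ≃ ι) {η : ι → Ω → ℝ} {B : ι → Ω → Bool}
    {f : ι → ℝ} {A : Matrix m n ℝ} {S : Ω → Matrix m n ℝ} {ρ γ δ F : ℝ} {k q : ℕ}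
    (hη : ∀ i, Measurable (η i)) (hB : ∀ i, Measurable (B i))
    (hindη : iIndepFun η μ) (hindB : iIndepFun B μ)
    (hindep : IndepFun (fun ω i => η i ω) (fun ω i => B i ω) μ)
    (hmean : ∀ i, ∫ ω, η i ω ∂μ = 0) (hγ : 0 < γ)
    (hpsi : ∀ i, psiTwoNorm μ (η i) ≤ ENNReal.ofReal γ)
    (hprob : ∀ i, μ {ω | B i ω = true} = ENNReal.ofReal ρ)
    (hρ : 0 < ρ) (hF : 0 < F) (hf : ∀ i, |f i| ≤ F)
    (hA : A.rank ≤ k) (hfA : ∀ i j, |f (e (i, j)) - A i j| ≤ δ) (hk : 1 ≤ k)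
    (hq : 1 ≤ q) (hm : Fintype.card m ≤ q) (hn : Fintype.card n ≤ q)
    (hcard : 1 ≤ Fintype.card ι) (hρcard : 1 ≤ ρ * Fintype.card ι)
    (hexp : Real.exp (-(ρ ^ 2 * Fintype.card ι / 2)) * (Fintype.card ι : ℝ) ^ 3 ≤ 1)
    (hS : ∀ ω, IsTruncatedSVD k
      (Matrix.of fun i j => reveal (B (e (i, j)) ω) * (f (e (i, j)) + η (e (i, j)) ω)) (S ω)) :
    ∃ h : Ω → ℝ, Integrable h μ ∧
      (∀ ω, ∑ i, ∑ j, (f (e (i, j)) -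
        (max 1 (∑ i, reveal (B i ω)) / Fintype.card ι)⁻¹ * S ω i j) ^ 2 ≤ h ω) ∧
      ∫ ω, h ω ∂μ ≤ 8 / ρ ^ 2 * (32 * k * (31104 * (F ^ 2 + 60 * γ ^ 2) * q) +
        34 * k * ρ ^ 2 * Fintype.card ι * δ ^ 2 + F ^ 2 / 4) + (6 * F ^ 2 + 8 * γ ^ 2) := by
  set D : ℝ := (Fintype.card ι : ℝ) with hD
  have hD1 : 1 ≤ D := by rw [hD]; exact_mod_cast hcard
  have hD0 : 0 < D := by linarith
  have hDmn : (Fintype.card m : ℝ) * Fintype.card n = D := by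
    rw [hD, ← Fintype.card_congr e, Fintype.card_prod]; push_cast; rfl
  set M : Matrix m n ℝ := Matrix.of fun i j => f (e (i, j)) with hM
  set Z : Ω → Matrix m n ℝ := fun ω =>
    Matrix.of fun i j => reveal (B (e (i, j)) ω) * (f (e (i, j)) + η (e (i, j)) ω) with hZ
  set E : Ω → Matrix m n ℝ := fun ω => Z ω - ρ • M with hE
  have hEij : ∀ ω i j, E ω i j = (reveal (B (e (i, j)) ω) - ρ) * f (e (i, j)) +
      reveal (B (e (i, j)) ω) * η (e (i, j)) ω := by
    intro ω i j
    simp only [hE, hZ, hM, Matrix.sub_apply, Matrix.smul_apply, Matrix.of_apply, smul_eq_mul]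
    ring
  have hsubE : IsJointlySubgaussian μ (fun ω (p : m × n) => E ω p.1 p.2) (F ^ 2 + 60 * γ ^ 2) := by
    have h := (isJointlySubgaussian_masked hη hB hindη hindB hindep
      (fun i => hasSubgaussianMGF_of_psiTwoNorm_le (hη i) hγ (hpsi i) (hmean i)) hρ.le hprob
      hf).comp_equiv e
    have hK : F ^ 2 + 2 * ((Real.toNNReal (30 * γ ^ 2) : NNReal) : ℝ) = F ^ 2 + 60 * γ ^ 2 := by
      rw [Real.coe_toNNReal _ (by positivity)]; ring
    rw [hK] at h
    simpa only [hEij] using h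
  have hEm : ∀ i j, Measurable fun ω => E ω i j := by
    intro i j
    simp only [hEij]
    have := measurable_reveal.comp (hB (e (i, j)))
    exact ((this.sub_const _).mul_const _).add (this.mul (hη _))
  obtain ⟨hEint, hEle⟩ := integral_norm_sq_le (by positivity) hq hm hn hEm hsubE
  obtain ⟨hRint, hRle⟩ := integral_sum_reveal_sub_sq_le hB hindB hρ.le hprob
  set s : Set (ι → Bool) := {b | ∑ i, reveal (b i) ≤ ρ * Fintype.card ι / 2} with hs
  set bad : Set Ω := {ω | (fun i => B i ω) ∈ s} with hbad
  have hbadm : MeasurableSet bad := (measurable_pi_lambda _ hB) s.toFinite.measurableSet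
  have hbadP : μ.real bad ≤ Real.exp (-(ρ ^ 2 * Fintype.card ι / 2)) :=
    measureReal_sum_reveal_le hB hindB hρ.le hprob
  obtain ⟨hNint, hNle⟩ := integral_indicator_sum_sq_le (s := s) hη hB hindep hγ.le hpsi
  have hCint : Integrable (bad.indicator fun _ => (1 : ℝ)) μ :=
    (integrable_const 1).indicator hbadm
  have hCle : ∫ ω, bad.indicator (fun _ => (1 : ℝ)) ω ∂μ = μ.real bad :=
    integral_indicator_one hbadm
  refine ⟨fun ω => 8 / ρ ^ 2 * (32 * k * ‖E ω‖ ^ 2 + 34 * k * ρ ^ 2 * D * δ ^ 2 +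
      F ^ 2 / D * (∑ i, reveal (B i ω) - ρ * D) ^ 2) +
      (6 * D ^ 3 * F ^ 2 * bad.indicator (fun _ => (1 : ℝ)) ω +
        4 * D ^ 2 * bad.indicator (fun ω => ∑ i, η i ω ^ 2) ω), ?_, fun ω => ?_, ?_⟩
  · exact ((((hEint.const_mul _).add (integrable_const _)).add (hRint.const_mul _)).const_mul _).add
      ((hCint.const_mul _).add (hNint.const_mul _))
  · set p : ℝ := max 1 (∑ i, reveal (B i ω)) / D with hp
    have hp0 : 0 < p := div_pos (lt_of_lt_of_le one_pos (le_max_left _ _)) hD0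
    have hMF : ∀ i j, |M i j| ≤ F := fun i j => hf _
    by_cases hω : ω ∈ bad
    · have hb := sum_sq_error_le_of_inv_card_le hp0
        (by rw [hDmn, hp, div_mul_cancel₀ _ hD0.ne']; exact le_max_left _ _) hMF (hS ω)
      rw [hDmn] at hb
      have hZ2 : ∑ i, ∑ j, Z ω i j ^ 2 ≤ 2 * D * F ^ 2 + 2 * ∑ i, η i ω ^ 2 := by
        have e1 : ∑ i, η i ω ^ 2 = ∑ i, ∑ j, η (e (i, j)) ω ^ 2 := by
          rw [← Fintype.sum_prod_type' (f := fun i j => η (e (i, j)) ω ^ 2)]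
          exact (e.sum_comp fun i => η i ω ^ 2).symm
        have e2 : D * F ^ 2 = ∑ _i : m, ∑ _j : n, F ^ 2 := by
          rw [← hDmn]; simp [mul_assoc]
        rw [mul_assoc, e1, e2]
        simp only [Finset.mul_sum, ← Finset.sum_add_distrib]
        refine Finset.sum_le_sum fun i _ => Finset.sum_le_sum fun j _ => ?_
        have hr := reveal_mem_Icc (B (e (i, j)) ω)
        have hfF : f (e (i, j)) ^ 2 ≤ F ^ 2 :=
          sq_le_sq' (abs_le.1 (hf _)).1 (abs_le.1 (hf _)).2
        calc Z ω i j ^ 2 = reveal (B (e (i, j)) ω) ^ 2 * (f (e (i, j)) + η (e (i, j)) ω) ^ 2 := by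
              simp only [hZ, Matrix.of_apply, mul_pow]
          _ ≤ 1 * (f (e (i, j)) + η (e (i, j)) ω) ^ 2 := by
              gcongr
              exact pow_le_one₀ hr.1 hr.2
          _ ≤ _ := by nlinarith [sq_nonneg (f (e (i, j)) - η (e (i, j)) ω)]
      beta_reduce
      rw [Set.indicator_of_mem hω, Set.indicator_of_mem hω]
      have hgood : 0 ≤ 8 / ρ ^ 2 * (32 * k * ‖E ω‖ ^ 2 + 34 * k * ρ ^ 2 * D * δ ^ 2 +
        F ^ 2 / D * (∑ i, reveal (B i ω) - ρ * D) ^ 2) := by positivity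
      have hD3 : D ≤ D ^ 3 := by nlinarith [mul_nonneg hD0.le (sub_nonneg.2 hD1)]
      calc _ ≤ 2 * D * F ^ 2 + 2 * D ^ 2 * ∑ i, ∑ j, Z ω i j ^ 2 := hb
        _ ≤ 2 * D ^ 3 * F ^ 2 + 2 * D ^ 2 * (2 * D * F ^ 2 + 2 * ∑ i, η i ω ^ 2) := by gcongr
        _ = 6 * D ^ 3 * F ^ 2 * 1 + 4 * D ^ 2 * ∑ i, η i ω ^ 2 := by ring
        _ ≤ _ := le_add_of_nonneg_left hgood
    · have hlt : ρ * D / 2 < ∑ i, reveal (B i ω) := not_le.1 hω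
      have hpρ : ρ / 2 ≤ p := by
        rw [hp, le_div_iff₀ hD0]
        exact le_trans (by linarith) (le_max_right _ _)
      have hb := sum_sq_error_le (M := M) (Z := Z ω) hρ hpρ hk hA hfA hMF (hS ω)
      rw [hDmn] at hb
      beta_reduce
      rw [Set.indicator_of_notMem hω, Set.indicator_of_notMem hω, mul_zero, mul_zero, add_zero,
        add_zero]
      refine hb.trans ?_
      have hpsq : (p - ρ) ^ 2 * D * F ^ 2 ≤ F ^ 2 / D * (∑ i, reveal (B i ω) - ρ * D) ^ 2 := by
        have e1 : (p - ρ) ^ 2 * D * F ^ 2 =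
            F ^ 2 / D * (max 1 (∑ i, reveal (B i ω)) - ρ * D) ^ 2 := by
          rw [hp]; field_simp
        rw [e1]
        exact mul_le_mul_of_nonneg_left (sq_le_sq.2 (abs_max_one_sub_le hρcard)) (by positivity)
      gcongr
  · have h1 : Integrable (fun ω => 32 * k * ‖E ω‖ ^ 2) μ := hEint.const_mul _
    have h2 : Integrable (fun ω => F ^ 2 / D * (∑ i, reveal (B i ω) - ρ * D) ^ 2) μ :=
      hRint.const_mul _
    have h3 : Integrable (fun ω => 6 * D ^ 3 * F ^ 2 * bad.indicator (fun _ => (1 : ℝ)) ω) μ :=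
      hCint.const_mul _
    have h4 : Integrable (fun ω => 4 * D ^ 2 * bad.indicator (fun ω => ∑ i, η i ω ^ 2) ω) μ :=
      hNint.const_mul _
    have h5 : Integrable (fun ω => 32 * k * ‖E ω‖ ^ 2 + 34 * k * ρ ^ 2 * D * δ ^ 2) μ :=
      h1.add (integrable_const _)
    have h6 : Integrable (fun ω => 8 / ρ ^ 2 * (32 * k * ‖E ω‖ ^ 2 + 34 * k * ρ ^ 2 * D * δ ^ 2 +
        F ^ 2 / D * (∑ i, reveal (B i ω) - ρ * D) ^ 2)) μ := (h5.add h2).const_mul _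
    have h7 : Integrable (fun ω => 6 * D ^ 3 * F ^ 2 * bad.indicator (fun _ => (1 : ℝ)) ω +
        4 * D ^ 2 * bad.indicator (fun ω => ∑ i, η i ω ^ 2) ω) μ := h3.add h4
    beta_reduce
    rw [integral_add h6 h7, integral_const_mul, integral_add h5 h2,
      integral_add h1 (integrable_const _), integral_add h3 h4, integral_const, probReal_univ,
      one_smul, integral_const_mul, integral_const_mul, integral_const_mul, integral_const_mul,
      hCle]
    have hbadD : 6 * D ^ 3 * F ^ 2 * μ.real bad +
        4 * D ^ 2 * ∫ ω, bad.indicator (fun ω => ∑ i, η i ω ^ 2) ω ∂μ ≤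
        6 * F ^ 2 + 8 * γ ^ 2 := by
      calc _ ≤ 6 * D ^ 3 * F ^ 2 * μ.real bad + 4 * D ^ 2 * (μ.real bad * (D * (2 * γ ^ 2))) := by
            gcongr
        _ = (μ.real bad * D ^ 3) * (6 * F ^ 2 + 8 * γ ^ 2) := by ring
        _ ≤ 1 * (6 * F ^ 2 + 8 * γ ^ 2) := by
            gcongr
            exact le_trans (by gcongr) hexp
        _ = _ := one_mul _
    refine add_le_add (mul_le_mul_of_nonneg_left (add_le_add (add_le_add ?_ le_rfl) ?_)
      (by positivity)) hbadD
    · gcongr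
    · calc _ ≤ F ^ 2 / D * (D / 4) := by gcongr
        _ = F ^ 2 / 4 := by field_simp

end Expectation

/-! ### The stacked Page matrix as a rearrangement of the data -/

section Page

variable {N T L : ℕ}

/-- The position in the stacked Page matrix determines the series and the time, and conversely. -/
def pageEquiv (N : ℕ) (hL : L ∣ T) (hL0 : 0 < L) :
    Fin L × (Fin N × Fin (T / L)) ≃ Fin N × Fin T where
  toFun p := (p.2.1, pageTime p.1 p.2.2)
  invFun x := (⟨(x.2 : ℕ) % L, Nat.mod_lt _ hL0⟩,
    (x.1, ⟨(x.2 : ℕ) / L, Nat.div_lt_div_of_lt_of_dvd hL x.2.2⟩))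
  left_inv p := by
    obtain ⟨i, n, j⟩ := p
    simp [pageTime, Nat.add_mul_div_right _ _ hL0, Nat.div_eq_of_lt i.2, Nat.mod_eq_of_lt i.2]
  right_inv x := by
    obtain ⟨n, t⟩ := x
    simp [pageTime, Nat.mod_add_div']

lemma readOff_pageTime (hL : L ∣ T) (A : Matrix (Fin L) (Fin N × Fin (T / L)) ℝ) (i : Fin L)
    (c : Fin N × Fin (T / L)) : readOff hL A c.1 (pageTime i c.2) = A i c := by
  have hL0 : 0 < L := Nat.zero_lt_of_lt i.2
  have h := (pageEquiv N hL hL0).left_inv (i, c)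
  have h1 : (⟨(pageTime i c.2 : ℕ) % L, Nat.mod_lt _ hL0⟩ : Fin L) = i := congrArg Prod.fst h
  have h2 : ((c.1, ⟨(pageTime i c.2 : ℕ) / L,
    Nat.div_lt_div_of_lt_of_dvd hL (pageTime i c.2).2⟩) : Fin N × Fin (T / L)) = c :=
    congrArg Prod.snd h
  unfold readOff
  rw [h1, h2]

lemma sum_sum_eq_sum_page (hL : L ∣ T) (hL0 : 0 < L) (g : Fin N → Fin T → ℝ) :
    ∑ n, ∑ t, g n t = ∑ i : Fin L, ∑ c : Fin N × Fin (T / L), g c.1 (pageTime i c.2) := by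
  rw [← Fintype.sum_prod_type', ← Fintype.sum_prod_type']
  exact ((pageEquiv N hL hL0).sum_comp fun x => g x.1 x.2).symm

end Page

section Model

variable {Ω : Type*} {N T : ℕ} {f : Fin N → ℤ → ℝ} {η : Fin N → Fin T → Ω → ℝ}
  {B : Fin N → Fin T → Ω → Bool}

lemma getD_observation (ω : Ω) (n : Fin N) (t : Fin T) :
    (observation f η B ω n t).getD 0 = reveal (B n t ω) * (window f T n t + η n t ω) := by
  by_cases h : B n t ω = true <;> simp [observation, reveal, h]

lemma rhoHat_observation (ω : Ω) :
    rhoHat (observation f η B ω) = max 1 (∑ i : Fin N × Fin T, reveal (B i.1 i.2 ω)) /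
      Fintype.card (Fin N × Fin T) := by
  have h : ∀ n t, (if (observation f η B ω n t).isSome then (1 : ℝ) else 0) = reveal (B n t ω) := by
    intro n t
    by_cases h : B n t ω = true <;> simp [observation, reveal, h]
  unfold rhoHat
  simp only [h]
  rw [Fintype.sum_prod_type]
  simp

lemma abs_window_le {R : ℕ} {Γ₁ Γ₂ : ℝ} {U : Fin N → Fin R → ℝ} {W : Fin R → ℤ → ℝ}
    (hΓ₁ : 0 ≤ Γ₁) (h : IsFactorModel f T R Γ₁ Γ₂ U W) (n : Fin N) (t : Fin T) :
    |window f T n t| ≤ R * Γ₁ * Γ₂ := by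
  have h1 : (1 : ℤ) ≤ (t : ℤ) + 1 := by omega
  have h2 : (t : ℤ) + 1 ≤ T := by have := t.2; omega
  unfold window
  rw [h.factor n _ h1 h2]
  calc _ ≤ ∑ r, |U n r * W r ((t : ℤ) + 1)| := Finset.abs_sum_le_sum_abs _ _
    _ ≤ ∑ _r : Fin R, Γ₁ * Γ₂ := by
        refine Finset.sum_le_sum fun r _ => ?_
        rw [abs_mul]
        exact mul_le_mul (h.spatial_bound n r) (h.temporal_bound r _ h1 h2) (abs_nonneg _) hΓ₁
    _ = _ := by simp [mul_assoc]

end Model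

/-! ### Collecting the constants -/

/-- With `ρ ≥ 3 * log D / √D` the exponent `ρ ^ 2 * D / 2` is at least `3 * log D`, so that the
event of few revealed entries has probability at most `D ^ (-3)`. -/
lemma rho_mul_card_bounds {D ρ : ℝ} (hD : 2 ≤ D) (hρ : 3 * Real.log D / √D ≤ ρ) :
    1 ≤ ρ * D ∧ Real.exp (-(ρ ^ 2 * D / 2)) * D ^ 3 ≤ 1 := by
  have hD0 : 0 < D := by linarith
  have hs : 0 < √D := Real.sqrt_pos.2 hD0
  have hs2 : √D ^ 2 = D := Real.sq_sqrt hD0.le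
  have hlog : 2 / 3 ≤ Real.log D := by
    have := Real.log_le_log (by norm_num) hD
    linarith [Real.log_two_gt_d9]
  have h1 : 3 * Real.log D ≤ ρ * √D := (div_le_iff₀ hs).1 hρ
  have hs1 : 1 ≤ √D := Real.one_le_sqrt.2 (by linarith)
  constructor
  · calc (1 : ℝ) ≤ (ρ * √D) * √D := by nlinarith
      _ = ρ * D := by rw [mul_assoc, ← sq, hs2]
  · have h2 : 6 * Real.log D ≤ ρ ^ 2 * D := by
      calc 6 * Real.log D ≤ (3 * Real.log D) ^ 2 := by nlinarith
        _ ≤ (ρ * √D) ^ 2 := by gcongr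
        _ = ρ ^ 2 * D := by rw [mul_pow, hs2]
    have h3 : D ^ 3 = Real.exp (3 * Real.log D) := by
      rw [mul_comm, Real.exp_mul, Real.exp_log hD0]
      norm_num
    rw [h3, ← Real.exp_add, Real.exp_le_one_iff]
    linarith

lemma error_bound_le {Γ₁ Γ₂ γ ε ρ ℓ : ℝ} {R G k q L : ℝ} (hρ0 : 0 < ρ)
    (hρ1 : ρ ≤ 1) (hR : 1 ≤ R) (hG : 1 ≤ G) (hk : k ≤ R * G) (hε : 0 ≤ ε)
    (hL : 1 ≤ L) (hq : 1 ≤ q) (hℓ : 1 / 2 ≤ ℓ) :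
    1 / (q * L) * (8 / ρ ^ 2 * (32 * k * (31104 * ((R * Γ₁ * Γ₂) ^ 2 + 60 * γ ^ 2) * q) +
        34 * k * ρ ^ 2 * (q * L) * (R * Γ₁ * ε) ^ 2 + (R * Γ₁ * Γ₂) ^ 2 / 4) +
        (6 * (R * Γ₁ * Γ₂) ^ 2 + 8 * γ ^ 2)) ≤
      (15925280 * (Γ₁ ^ 2 * Γ₂ ^ 2 + 60 * γ ^ 2) + 136 * Γ₁ ^ 2) *
        (R ^ 3 * G * ℓ / (ρ ^ 4 * L) + R ^ 4 * G * (ε + ε ^ 3) / ρ ^ 2) := by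
  have hR0 : 0 < R := by linarith
  have hG0 : 0 < G := by linarith
  have hL0 : 0 < L := by linarith
  have hq0 : 0 < q := by linarith
  set K := Γ₁ ^ 2 * Γ₂ ^ 2 + 60 * γ ^ 2 with hK
  have hK0 : 0 ≤ K := by positivity
  have hR2 : 1 ≤ R ^ 2 := one_le_pow₀ hR
  have hρ2 : 0 < ρ ^ 2 := by positivity
  have hρ21 : ρ ^ 2 ≤ 1 := pow_le_one₀ hρ0.le hρ1
  have hKR : (R * Γ₁ * Γ₂) ^ 2 + 60 * γ ^ 2 ≤ R ^ 2 * K := by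
    rw [hK]; nlinarith [sq_nonneg γ]
  have hF : (R * Γ₁ * Γ₂) ^ 2 ≤ R ^ 2 * K := by nlinarith [sq_nonneg γ]
  have hγ : γ ^ 2 ≤ R ^ 2 * K := by nlinarith [sq_nonneg γ, sq_nonneg (R * Γ₁ * Γ₂)]
  have hA : R ^ 2 * K ≤ R ^ 3 * G * K := by
    have : R ^ 2 * 1 ≤ R ^ 2 * (R * G) := by gcongr; nlinarith
    nlinarith
  have t1 : 1 / (q * L) * (8 / ρ ^ 2 *
      (32 * k * (31104 * ((R * Γ₁ * Γ₂) ^ 2 + 60 * γ ^ 2) * q))) ≤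
      7962624 * (R ^ 3 * G * K / (ρ ^ 2 * L)) := by
    calc _ = 7962624 * (k * ((R * Γ₁ * Γ₂) ^ 2 + 60 * γ ^ 2) / (ρ ^ 2 * L)) := by
          field_simp; ring
      _ ≤ 7962624 * (R * G * (R ^ 2 * K) / (ρ ^ 2 * L)) := by gcongr
      _ = _ := by ring
  have t2 : 1 / (q * L) * (8 / ρ ^ 2 * (34 * k * ρ ^ 2 * (q * L) * (R * Γ₁ * ε) ^ 2)) ≤
      136 * Γ₁ ^ 2 * (R ^ 4 * G * (ε + ε ^ 3) / ρ ^ 2) := by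
    calc _ = 272 * k * (R * Γ₁ * ε) ^ 2 := by field_simp; ring
      _ ≤ 272 * (R * G) * (R * Γ₁ * ε) ^ 2 := by gcongr
      _ = 136 * Γ₁ ^ 2 * (R ^ 3 * G * (2 * ε ^ 2)) := by ring
      _ ≤ 136 * Γ₁ ^ 2 * (R ^ 4 * G * (ε + ε ^ 3)) := by
          have : 2 * ε ^ 2 ≤ ε + ε ^ 3 := by nlinarith [mul_nonneg hε (sq_nonneg (ε - 1))]
          have h3 : R ^ 3 ≤ R ^ 4 := pow_le_pow_right₀ hR (by norm_num)
          gcongr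
      _ ≤ _ := by
          gcongr
          exact le_div_self (by positivity) hρ2 hρ21
  have t3 : 1 / (q * L) * (8 / ρ ^ 2 * ((R * Γ₁ * Γ₂) ^ 2 / 4) +
      (6 * (R * Γ₁ * Γ₂) ^ 2 + 8 * γ ^ 2)) ≤ 16 * (R ^ 3 * G * K / (ρ ^ 2 * L)) := by
    have h1 : 8 / ρ ^ 2 * ((R * Γ₁ * Γ₂) ^ 2 / 4) + (6 * (R * Γ₁ * Γ₂) ^ 2 + 8 * γ ^ 2) ≤
        16 * (R ^ 3 * G * K) / ρ ^ 2 := by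
      calc _ ≤ 8 / ρ ^ 2 * (R ^ 3 * G * K / 4) + (6 * (R ^ 3 * G * K) + 8 * (R ^ 3 * G * K)) := by
            gcongr <;> linarith
        _ = 2 * (R ^ 3 * G * K) / ρ ^ 2 + 14 * (R ^ 3 * G * K) := by ring
        _ ≤ 2 * (R ^ 3 * G * K) / ρ ^ 2 + 14 * (R ^ 3 * G * K) / ρ ^ 2 := by
            gcongr
            exact le_div_self (by positivity) hρ2 hρ21
        _ = _ := by ring
    have h2 : 1 / (q * L) ≤ 1 / L := one_div_le_one_div_of_le hL0 (by nlinarith)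
    calc _ ≤ 1 / L * (16 * (R ^ 3 * G * K) / ρ ^ 2) := by gcongr
      _ = _ := by field_simp
  have t4 : R ^ 3 * G * K / (ρ ^ 2 * L) ≤ 2 * K * (R ^ 3 * G * ℓ / (ρ ^ 4 * L)) := by
    have h1 : R ^ 3 * G * K ≤ 2 * K * (R ^ 3 * G * ℓ) / ρ ^ 2 := by
      refine le_trans ?_ (le_div_self (by positivity) hρ2 hρ21)
      nlinarith [show 0 ≤ R ^ 3 * G * K by positivity]
    calc _ ≤ (2 * K * (R ^ 3 * G * ℓ) / ρ ^ 2) / (ρ ^ 2 * L) := by gcongr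
      _ = _ := by field_simp
  have t5 : 7962640 * (R ^ 3 * G * K / (ρ ^ 2 * L)) ≤
      15925280 * K * (R ^ 3 * G * ℓ / (ρ ^ 4 * L)) := by
    calc _ ≤ 7962640 * (2 * K * (R ^ 3 * G * ℓ / (ρ ^ 4 * L))) := by gcongr
      _ = _ := by ring
  generalize R ^ 3 * G * K / (ρ ^ 2 * L) = z at *
  have hx : 0 ≤ R ^ 3 * G * ℓ / (ρ ^ 4 * L) := by positivity
  have hy : 0 ≤ R ^ 4 * G * (ε + ε ^ 3) / ρ ^ 2 := by positivity
  generalize R ^ 3 * G * ℓ / (ρ ^ 4 * L) = x at *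
  generalize R ^ 4 * G * (ε + ε ^ 3) / ρ ^ 2 = y at *
  calc _ = 1 / (q * L) * (8 / ρ ^ 2 *
          (32 * k * (31104 * ((R * Γ₁ * Γ₂) ^ 2 + 60 * γ ^ 2) * q))) +
        1 / (q * L) * (8 / ρ ^ 2 * (34 * k * ρ ^ 2 * (q * L) * (R * Γ₁ * ε) ^ 2)) +
        1 / (q * L) * (8 / ρ ^ 2 * ((R * Γ₁ * Γ₂) ^ 2 / 4) +
          (6 * (R * Γ₁ * Γ₂) ^ 2 + 8 * γ ^ 2)) := by ring
    _ ≤ 7962624 * z + 136 * Γ₁ ^ 2 * y + 16 * z := add_le_add (add_le_add t1 t2) t3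
    _ = 7962640 * z + 136 * Γ₁ ^ 2 * y := by ring
    _ ≤ 15925280 * K * x + 136 * Γ₁ ^ 2 * y := by gcongr
    _ ≤ 15925280 * K * x + 136 * Γ₁ ^ 2 * y + (15925280 * K * y + 136 * Γ₁ ^ 2 * x) :=
        le_add_of_nonneg_right (by positivity)
    _ = _ := by ring

end MSSA

theorem mainTheorem1 :
    ∃ C₀ : ℝ, 0 < C₀ ∧ ∃ P : MvPolynomial (Fin 4) ℝ,
      (∀ c Γ₁ Γ₂ γ : ℝ, 0 < c → 0 < Γ₁ → 0 < Γ₂ → 0 ≤ γ →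
        0 < MvPolynomial.eval ![c, Γ₁, Γ₂, γ] P) ∧
      ∀ (Ω : Type*) [MeasurableSpace Ω] (μ : Measure Ω) [IsProbabilityMeasure μ]
        (N T L R G k : ℕ) (c Γ₁ Γ₂ γ ε ρ : ℝ)
        (f : Fin N → ℤ → ℝ) (U : Fin N → Fin R → ℝ) (W : Fin R → ℤ → ℝ)
        (η : Fin N → Fin T → Ω → ℝ) (B : Fin N → Fin T → Ω → Bool)
        (fhat : Ω → Fin N → Fin T → ℝ) (hLT : L ∣ T),
        2 ≤ N * T →
        (L : ℝ) = √((min N T : ℕ) * (T : ℝ)) →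
        0 < c → 0 < Γ₁ → 0 < Γ₂ → 0 ≤ γ → 0 ≤ ε → 0 < ρ → ρ ≤ 1 →
        MSSA.IsFactorModel f T R Γ₁ Γ₂ U W →
        (∀ r, MSSA.IsHankelSeries G ε (W r)) →
        MSSA.IsObservationModel μ η B ρ γ →
        MSSA.ApproxBalancedSpectra f T L R G Γ₁ ε c k →
        C₀ * Real.log ((N : ℝ) * T) / √((N : ℝ) * T) ≤ ρ →
        (∀ ω, MSSA.IsMSSAImputation hLT k (MSSA.observation f η B ω) (fhat ω)) →
        (∀ n t, AEMeasurable (fun ω => fhat ω n t) μ) →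
        (∀ n t, Integrable (fun ω => (MSSA.window f T n t - fhat ω n t) ^ 2) μ) ∧
        MSSA.impErr μ f fhat ≤
          MvPolynomial.eval ![c, Γ₁, Γ₂, γ] P *
            ((R : ℝ) ^ 3 * G * Real.log ((N : ℝ) * T) /
                (ρ ^ 4 * √((min N T : ℕ) * (T : ℝ))) +
              (R : ℝ) ^ 4 * G * (ε + ε ^ 3) / ρ ^ 2) := by

  refine ⟨3, by norm_num,
    MvPolynomial.C 15925280 * (MvPolynomial.X 1 ^ 2 * MvPolynomial.X 2 ^ 2 +
      MvPolynomial.C 60 * (MvPolynomial.X 3 + 1) ^ 2) +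
      MvPolynomial.C 136 * MvPolynomial.X 1 ^ 2, ?_, ?_⟩
  · intro c Γ₁ Γ₂ γ hc h1 h2 hγ
    simp only [map_add, map_mul, map_pow, MvPolynomial.eval_C, MvPolynomial.eval_X, map_one]
    simp only [Matrix.cons_val]
    positivity
  intro Ω _ μ _ N T L R G k c Γ₁ Γ₂ γ ε ρ f U W η B fhat hLT hNT hL hc hΓ₁ hΓ₂ hγ hε hρ0 hρ1
    hfac _ hobs hbal hρ himp hmeas
  obtain ⟨A, hArank, hk1, hkRG, hA, -⟩ := hbal
  have hN : 0 < N := Nat.pos_of_ne_zero (by rintro rfl; omega)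
  have hT : 0 < T := Nat.pos_of_ne_zero (by rintro rfl; omega)
  have hL0 : 0 < L := Nat.pos_of_dvd_of_pos hLT hT
  have hRG : 0 < R * G := by omega
  have hR : 1 ≤ R := Nat.pos_of_mul_pos_right hRG
  have hG : 1 ≤ G := Nat.pos_of_mul_pos_left hRG
  -- `q` is the number of columns of the stacked Page matrix; it is at least the number `L` of rows.
  set q : ℕ := N * (T / L) with hq
  have hqL : q * L = N * T := by rw [hq, mul_assoc, Nat.div_mul_cancel hLT]
  have hLq : L ≤ q := by
    have h1 : (L : ℝ) ^ 2 = (min N T : ℕ) * (T : ℝ) := by rw [hL, Real.sq_sqrt (by positivity)]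
    have h2 : L ^ 2 = min N T * T := by exact_mod_cast h1
    refine Nat.le_of_mul_le_mul_right ?_ hL0
    rw [hqL, ← sq, h2]
    exact Nat.mul_le_mul_right T (min_le_left N T)
  have hD : Fintype.card (Fin N × Fin T) = N * T := by simp
  have hDR : ((Fintype.card (Fin N × Fin T) : ℕ) : ℝ) = (N : ℝ) * T := by rw [hD]; push_cast; rfl
  have hD2 : (2 : ℝ) ≤ (N : ℝ) * T := by exact_mod_cast hNT
  obtain ⟨hρD, hexp⟩ := MSSA.rho_mul_card_bounds hD2 hρ
  rw [← hDR] at hρD hexp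
  choose S hS hfhat using himp
  have hR0 : (0 : ℝ) < R := by exact_mod_cast hR
  have hS' : ∀ ω, MSSA.IsTruncatedSVD k
      (Matrix.of fun (i : Fin L) (p : Fin N × Fin (T / L)) =>
        MSSA.reveal (B p.1 (MSSA.pageTime i p.2) ω) *
          (MSSA.window f T p.1 (MSSA.pageTime i p.2) + η p.1 (MSSA.pageTime i p.2) ω)) (S ω) := by
    intro ω
    have h := hS ω
    have e : (MSSA.stackedPage L fun n t => (MSSA.observation f η B ω n t).getD 0) =
        Matrix.of fun (i : Fin L) (p : Fin N × Fin (T / L)) =>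
        MSSA.reveal (B p.1 (MSSA.pageTime i p.2) ω) *
          (MSSA.window f T p.1 (MSSA.pageTime i p.2) + η p.1 (MSSA.pageTime i p.2) ω) := by
      ext i p
      exact MSSA.getD_observation ω _ _
    rwa [e] at h
  -- The noise level is enlarged to `γ + 1` in order that it be positive.
  obtain ⟨h, hint, hle, hval⟩ := MSSA.exists_integrable_error_bound (μ := μ)
    (MSSA.pageEquiv N hLT hL0) (η := fun i => η i.1 i.2) (B := fun i => B i.1 i.2)
    (f := fun i => MSSA.window f T i.1 i.2) (A := A) (S := S) (ρ := ρ) (γ := γ + 1)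
    (δ := R * Γ₁ * ε) (F := R * Γ₁ * Γ₂) (k := k) (q := q)
    (fun i => hobs.measurable_noise _ _) (fun i => hobs.measurable_mask _ _)
    hobs.indep_noise hobs.indep_mask hobs.indep_noise_mask (fun i => hobs.integral_noise _ _)
    (by positivity)
    (fun i => (hobs.noise_norm _ _).trans (ENNReal.ofReal_le_ofReal (by linarith)))
    (fun i => hobs.mask_prob _ _) hρ0 (by positivity)
    (fun i => MSSA.abs_window_le hΓ₁.le hfac _ _) hArank.le hA hk1 (hL0.trans_le hLq)
    (by simpa using hLq) (by simp [hq]) (by rw [hD]; omega) hρD hexp hS'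
  have herr : ∀ ω, ∑ n, ∑ t, (MSSA.window f T n t - fhat ω n t) ^ 2 ≤ h ω := by
    intro ω
    rw [MSSA.sum_sum_eq_sum_page hLT hL0]
    refine le_trans (le_of_eq ?_) (hle ω)
    refine Finset.sum_congr rfl fun i _ => Finset.sum_congr rfl fun p _ => ?_
    rw [hfhat, MSSA.readOff_pageTime, MSSA.rhoHat_observation]
    rfl
  have hsq : ∀ n t, Integrable (fun ω => (MSSA.window f T n t - fhat ω n t) ^ 2) μ := by
    intro n t
    refine hint.mono' ((hmeas n t).const_sub _ |>.pow_const 2).aestronglyMeasurable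
      (Filter.Eventually.of_forall fun ω => ?_)
    rw [Real.norm_eq_abs, abs_of_nonneg (sq_nonneg _)]
    refine le_trans ?_ (herr ω)
    refine le_trans ?_ (Finset.single_le_sum (f := fun n => ∑ t,
      (MSSA.window f T n t - fhat ω n t) ^ 2)
      (fun n _ => Finset.sum_nonneg fun t _ => sq_nonneg _) (Finset.mem_univ n))
    exact Finset.single_le_sum (f := fun t => (MSSA.window f T n t - fhat ω n t) ^ 2)
      (fun t _ => sq_nonneg _) (Finset.mem_univ t)
  refine ⟨hsq, ?_⟩
  have hsum : ∑ n, ∑ t, ∫ ω, (MSSA.window f T n t - fhat ω n t) ^ 2 ∂μ ≤ ∫ ω, h ω ∂μ := by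
    simp only [← integral_finsetSum _ fun t _ => hsq _ t]
    rw [← integral_finsetSum _ fun n _ => integrable_finsetSum _ fun t _ => hsq n t]
    exact integral_mono
      (integrable_finsetSum _ fun n _ => integrable_finsetSum _ fun t _ => hsq n t) hint herr
  have hqLR : (N : ℝ) * T = q * L := by exact_mod_cast hqL.symm
  have hlog : 1 / 2 ≤ Real.log ((N : ℝ) * T) := by
    have := Real.log_le_log (by norm_num) hD2
    linarith [Real.log_two_gt_d9]
  have hfinal := MSSA.error_bound_le (Γ₁ := Γ₁) (Γ₂ := Γ₂) (γ := γ + 1) (ε := ε) (ρ := ρ)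
    (ℓ := Real.log ((N : ℝ) * T)) (R := R) (G := G) (k := k) (q := q) (L := L) hρ0 hρ1
    (by exact_mod_cast hR) (by exact_mod_cast hG) (by exact_mod_cast hkRG) hε
    (by exact_mod_cast hL0) (by exact_mod_cast hL0.trans_le hLq) hlog
  simp only [map_add, map_mul, map_pow, MvPolynomial.eval_C, MvPolynomial.eval_X, map_one]
  simp only [Matrix.cons_val]
  rw [← hL]
  refine le_trans ?_ hfinal
  unfold MSSA.impErr
  rw [← hqLR]
  refine mul_le_mul_of_nonneg_left (hsum.trans ?_) (by positivity)
  rwa [hDR] at hval
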